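/- **Setting.** Let $\mathcal D$ (users) and $H$ (time slots) be finite sets, $K_h>0$ and $\alpha(h)>0$ for $h\in H$, $\beta_m\ge 0$, and for every $n\in\mathcal D$ let $\Omega_n\subset\mathbb R^{H}$ be nonempty, compact and convex. Loads are $\boldsymbol l=(\boldsymbol l_n)_n$ with $\boldsymbol l_n\in\Omega_n$, errors are $\boldsymbol\delta=(\boldsymbol\delta_n)_n$ with $\boldsymbol\delta_n\in\mathbb R^{H}$, and the total load $L(h)=\sum_n l_n(h)$ is assumed to be positive for all feasible loads and all $h$. Put $$f_n(\boldsymbol l,\boldsymbol\delta)=\sum_{h}K_h\Big(L(h)+\sum_{k}\delta_k(h)\Big)(l_n(h)+\delta_n(h))+\beta_m\|\boldsymbol\delta_n\|_2^2,\qquad p_n(\boldsymbol l,\boldsymbol\delta,\boldsymbol\lambda)=f_n(\boldsymbol l,\boldsymbol\delta)-\sum_h\lambda_h\delta_n(h)^2 .$$ *The robust game $\mathcal G_m$:* user $n$ solves $\min_{\boldsymbol l_n\in\Omega_n}\max_{\boldsymbol\delta_n}f_n$, where the maximum is subject to the shared constraints $\|\boldsymbol\delta(h)\|_2^2=\sum_k\delta_k(h)^2\le\alpha(h)$,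 $h\in H$. At an equilibrium every $\boldsymbol\delta_n$ attains the maximum and every $\boldsymbol l_n$ minimizes the worst-case cost, the other users' strategies being fixed. An equilibrium is *variational* (normalized) if the maximization problems of all users satisfy the KKT conditions for the shared constraints with common multipliers $\lambda_h\ge0$. *The reformulated game $\tilde{\mathcal G}_m(\boldsymbol\lambda)$:* user $n$ solves $\min_{\boldsymbol l_n\in\Omega_n}\max_{\boldsymbol\delta_n\in\mathbb R^{H}}p_n(\boldsymbol l,\boldsymbol\delta,\boldsymbol\lambda)$; at a (Nash) equilibrium $(\boldsymbol l,\boldsymbol\delta)$ every $(\boldsymbol l_n,\boldsymbol\delta_n)$ is a saddle point of $p_n$, so that it solves both the min-max and the max-min problem of user $n$. The game is accompanied by the complementarity problem $$0<K_h+\beta_m\le\lambda_h\ \perp\ \alpha(h)-\|\boldsymbol\delta(h)\|_2^2\ge0\quad\text{for all }h\in H.\tag{NCP}$$ **Theorem.** (a) The set of solutions $(\boldsymbol l,\boldsymbol\delta,\boldsymbol\lambda)$ of the game $\tilde{\mathcal G}_m(\boldsymbol\lambda)$ together with (NCP) is nonempty and compact. Also, for every fixed $\boldsymbol\lambda$ with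 $\lambda_h\ge K_h+\beta_m$ and $\lambda_h\ne\frac12K_h(|\mathcal D|+1)+\beta_m$ for all $h$, the set of equilibria $(\boldsymbol l,\boldsymbol\delta)$ of $\tilde{\mathcal G}_m(\boldsymbol\lambda)$ is nonempty and compact. (b) The robust game $\mathcal G_m$ has a variational solution. (c) Let $\lambda_h>\frac12K_h(|\mathcal D|+1)+\beta_m$ for all $h$. Then $\tilde{\mathcal G}_m(\boldsymbol\lambda)$ is strongly monotone in the error variables: the map $\boldsymbol\delta\mapsto(-\nabla_{\boldsymbol\delta_n}p_n(\boldsymbol l,\boldsymbol\delta,\boldsymbol\lambda))_n$ is strongly monotone with a constant independent of the feasible $\boldsymbol l$. The game has a unique Nash equilibrium $(\boldsymbol l^\ast,\boldsymbol\delta^\ast)$, and no other pair solves the min-max problems of all users. It is reached by distributed asynchronous best-response algorithms (each user updates infinitely often, at its own times, by a best response to possibly outdated strategies of the others, where outdated information is eventually purged), in the following sense: - *Error variables.* For all feasible loads $\boldsymbol l$ the game in which every user $n$ maximizes $p_n$ over $\boldsymbol\delta_n$ has a unique equilibrium, and the asynchronous best-response algorithm for it is well defined and converges to this equilibrium for every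 schedule and every starting point. For $\boldsymbol l=\boldsymbol l^\ast$ the limit is $\boldsymbol\delta^\ast$. - *Loads and errors.* For all sufficiently large $\tau$: if the proximal term $\frac\tau2\|\boldsymbol l_n-\boldsymbol z_n\|^2$ with feasible centroids $\boldsymbol z$ is added to $p_n$, then the resulting game has a unique equilibrium, to which the asynchronous best-response algorithm in $(\boldsymbol l,\boldsymbol\delta)$ is well defined and converges for every schedule and every feasible start; and if the centroids are repeatedly replaced by the loads of this equilibrium, then the loads and errors converge to $(\boldsymbol l^\ast,\boldsymbol\delta^\ast)$. -/

import Mathlib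

open Filter Topology

/-- The data and standing assumptions of the demand-side model: `D` is the set of users, `H` the
set of time slots. -/
structure GridModel (D H : Type*) [Fintype D] where
  /-- energy cost coefficient of each slot -/
  K : H → ℝ
  /-- bound on the squared Euclidean norm of the errors of a slot -/
  α : H → ℝ
  /-- weight of the management cost `M(δ_n) = β ‖δ_n‖²` -/
  β : ℝ
  /-- feasible load profiles of each user -/
  Ω : D → Set (H → ℝ)
  K_pos : ∀ h, 0 < K h
  α_pos : ∀ h, 0 < α h
  β_nonneg : 0 ≤ β
  Ω_nonempty : ∀ n, (Ω n).Nonempty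
  Ω_compact : ∀ n, IsCompact (Ω n)
  Ω_convex : ∀ n, Convex ℝ (Ω n)
  /-- the aggregate load of every slot is positive -/
  load_pos : ∀ l : D → H → ℝ, (∀ n, l n ∈ Ω n) → ∀ h, 0 < ∑ n, l n h

/-- `setEntry δ n h t` is `δ` with the entry `δ_n(h)` replaced by `t`. -/
def setEntry {D H : Type*} [DecidableEq D] [DecidableEq H]
    (δ : D → H → ℝ) (n : D) (h : H) (t : ℝ) : D → H → ℝ :=
  Function.update δ n (Function.update (δ n) h t)

/-- The worst case (a supremum in `[-∞, ∞]`) of the cost `f n l δ` of user `n` over the error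
profiles `d ∈ S` of user `n`, all other variables being fixed. -/
noncomputable def worstCase {D H : Type*} [DecidableEq D]
    (f : D → (D → H → ℝ) → (D → H → ℝ) → ℝ) (S : Set (H → ℝ)) (n : D)
    (l δ : D → H → ℝ) : EReal :=
  ⨆ d ∈ S, (f n l (Function.update δ n d) : EReal)

/-- `(l, δ)` is a (generalized) Nash equilibrium of the game in which each user `n` solves
`min_{l_n ∈ Ω n} max_{δ_n ∈ S n δ} f n l δ`; the region `S n δ` for `δ_n` may depend on the errors
of the other users. The error `δ_n` attains the maximum at `l`, and `l_n` minimizes the worst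
case. -/
def IsMinMaxEquilibrium {D H : Type*} [DecidableEq D]
    (f : D → (D → H → ℝ) → (D → H → ℝ) → ℝ) (Ω : D → Set (H → ℝ))
    (S : D → (D → H → ℝ) → Set (H → ℝ)) (l δ : D → H → ℝ) : Prop :=
  ∀ n, l n ∈ Ω n ∧ δ n ∈ S n δ ∧
    (∀ d ∈ S n δ, f n l (Function.update δ n d) ≤ f n l δ) ∧
    (∀ m ∈ Ω n, worstCase f (S n δ) n l δ ≤ worstCase f (S n δ) n (Function.update l n m) δ)

/-- In the game with costs `f`, the strategy `(l n, δ n)` of user `n` is a best response to the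
strategies of the other users: it is a saddle point of the cost of user `n` over `l_n ∈ Ω n`
(minimized) and an unconstrained `δ_n` (maximized). It thus solves the min-max problem of the user
and also the max-min problem with the two operations interchanged. -/
def IsUserSaddle {D H : Type*} [DecidableEq D]
    (f : D → (D → H → ℝ) → (D → H → ℝ) → ℝ) (Ω : D → Set (H → ℝ)) (n : D)
    (l δ : D → H → ℝ) : Prop :=
  l n ∈ Ω n ∧
    (∀ m ∈ Ω n, f n l δ ≤ f n (Function.update l n m) δ) ∧
    (∀ d : H → ℝ, f n l (Function.update δ n d) ≤ f n l δ)

/-- The parameters of a totally asynchronous iteration: user `n` updates at the times in `upd n`,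
and at time `i` it uses the strategy that user `k` had at time `time n k i`. Information is never
from the future, outdated information is eventually purged, and every user updates infinitely
often. -/
structure AsyncSchedule (D : Type*) where
  upd : D → Set ℕ
  time : D → D → ℕ → ℕ
  time_le : ∀ n k i, time n k i ≤ i
  time_tendsto : ∀ n k B, ∃ N, ∀ i ∈ upd n, N ≤ i → B ≤ time n k i
  upd_infinite : ∀ n, (upd n).Infinite

namespace GridModel

variable {D H : Type*} [Fintype D] [DecidableEq D] [Fintype H] [DecidableEq H]

/-- The cost of user `n`:
`f_n(l, δ) = ∑_h K_h (L(h) + ∑_k δ_k(h)) (l_n(h) + δ_n(h)) + β ‖δ_n‖²`. -/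
def cost (G : GridModel D H) (n : D) (l δ : D → H → ℝ) : ℝ :=
  ∑ h, G.K h * (∑ k, l k h + ∑ k, δ k h) * (l n h + δ n h) + G.β * ∑ h, δ n h ^ 2

/-- The penalized cost `p_n(l, δ, λ)` of user `n`. -/
def penCost (G : GridModel D H) (lam : H → ℝ) (n : D) (l δ : D → H → ℝ) : ℝ :=
  ∑ h, (G.β - lam h) * δ n h ^ 2 +
    ∑ h, G.K h * (∑ k, l k h + ∑ k, δ k h) * (l n h + δ n h)

/-- The error profiles of user `n` that satisfy the shared constraints `‖δ(h)‖² ≤ α(h)`,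
`h ∈ H`, given the errors of the other users. -/
def errorSlice (G : GridModel D H) (n : D) (δ : D → H → ℝ) : Set (H → ℝ) :=
  {d | ∀ h, ∑ k, Function.update δ n d k h ^ 2 ≤ G.α h}

/-- `(l, δ)` is an equilibrium of the robust game, in which user `n` solves
`min_{l_n ∈ Ω n} max_{δ_n} f_n(l, δ)` subject to `‖δ(h)‖² ≤ α(h)` for all `h`. -/
def IsRobustEquilibrium (G : GridModel D H) (l δ : D → H → ℝ) : Prop :=
  IsMinMaxEquilibrium G.cost G.Ω G.errorSlice l δ

/-- A variational (normalized) solution of the robust game: an equilibrium at which the maximization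
problems of all users satisfy the Karush-Kuhn-Tucker conditions for the shared constraints with
multipliers `lam h` that are common to all users. -/
def IsVariationalSolution (G : GridModel D H) (l δ : D → H → ℝ) : Prop :=
  G.IsRobustEquilibrium l δ ∧
    ∃ lam : H → ℝ,
      (∀ h, 0 ≤ lam h) ∧
      (∀ h, lam h * (∑ k, δ k h ^ 2 - G.α h) = 0) ∧
      ∀ n h, deriv (fun t => G.cost n l (setEntry δ n h t)) (δ n h) =
        lam h * deriv (fun t => ∑ k, setEntry δ n h t k h ^ 2 - G.α h) (δ n h)

/-- `(l, δ)` is an equilibrium of the min-max formulation of the reformulated game with multipliers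
`lam`: user `n` solves `min_{l_n ∈ Ω n} max_{δ_n} p_n(l, δ, λ)`, with `δ_n` unconstrained. -/
def IsPenMinMaxEquilibrium (G : GridModel D H) (lam : H → ℝ) (l δ : D → H → ℝ) : Prop :=
  IsMinMaxEquilibrium (G.penCost lam) G.Ω (fun _ _ => Set.univ) l δ

/-- `δ` is a Nash equilibrium of the inner game at the fixed loads `l`: each user `n` maximizes
`p_n(l, δ, λ)` over its own error profile `δ_n`. -/
def IsInnerEquilibrium (G : GridModel D H) (lam : H → ℝ) (l δ : D → H → ℝ) : Prop :=
  ∀ n d, G.penCost lam n l (Function.update δ n d) ≤ G.penCost lam n l δ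

/-- `(l, δ)` is a Nash equilibrium of the reformulated game with multipliers `lam`: every user plays
a saddle point of its penalized cost. -/
def IsPenEquilibrium (G : GridModel D H) (lam : H → ℝ) (l δ : D → H → ℝ) : Prop :=
  ∀ n, IsUserSaddle (G.penCost lam) G.Ω n l δ

/-- The nonlinear complementarity problem
`0 < K_h + β ≤ λ_h ⊥ α(h) - ‖δ(h)‖² ≥ 0` for all `h`. -/
def NCP (G : GridModel D H) (lam : H → ℝ) (δ : D → H → ℝ) : Prop :=
  ∀ h, 0 < G.K h + G.β ∧ G.K h + G.β ≤ lam h ∧ 0 ≤ G.α h - ∑ k, δ k h ^ 2 ∧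
    lam h * (G.α h - ∑ k, δ k h ^ 2) = 0

/-- The component `-∂p_n / ∂δ_n(h)` of the operator of the variational inequality of the game in
the error variables (the users maximize `p_n` over `δ_n`). -/
noncomputable def errorField (G : GridModel D H) (lam : H → ℝ) (l δ : D → H → ℝ)
    (n : D) (h : H) : ℝ :=
  -deriv (fun t => G.penCost lam n l (setEntry δ n h t)) (δ n h)

/-- The reformulated game is strongly monotone in the error variables, uniformly in the feasible
loads. -/
def StronglyMonotoneInErrors (G : GridModel D H) (lam : H → ℝ) : Prop :=
  ∃ c : ℝ, 0 < c ∧ ∀ l : D → H → ℝ, (∀ n, l n ∈ G.Ω n) → ∀ δ ε : D → H → ℝ,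
    c * ∑ n, ∑ h, (δ n h - ε n h) ^ 2 ≤
      ∑ n, ∑ h, (G.errorField lam l δ n h - G.errorField lam l ε n h) * (δ n h - ε n h)

/-- `x` is a run of the distributed asynchronous best-response algorithm in the error variables at
the loads `l`: when user `n` updates at time `i`, it chooses an error profile that maximizes `p_n`
against the possibly outdated profiles of the other users; otherwise it keeps its profile. -/
def IsAsyncRun (G : GridModel D H) (lam : H → ℝ) (l : D → H → ℝ) (s : AsyncSchedule D)
    (x : ℕ → D → H → ℝ) : Prop :=
  ∀ i n,
    (i ∈ s.upd n → ∀ d : H → ℝ,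
      G.penCost lam n l (Function.update (fun k => x (s.time n k i) k) n d) ≤
        G.penCost lam n l (Function.update (fun k => x (s.time n k i) k) n (x (i + 1) n))) ∧
    (i ∉ s.upd n → x (i + 1) n = x i n)

/-- The asynchronous best-response algorithm reaches `δ` at the loads `l`: for every schedule and
every starting point it can be run, and every run converges to `δ`. -/
def AsyncReaches (G : GridModel D H) (lam : H → ℝ) (l δ : D → H → ℝ) : Prop :=
  ∀ (s : AsyncSchedule D) (x₀ : D → H → ℝ),
    (∃ x, x 0 = x₀ ∧ G.IsAsyncRun lam l s x) ∧
    ∀ x, x 0 = x₀ → G.IsAsyncRun lam l s x → Tendsto x atTop (𝓝 δ)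

/-- The penalized cost with the proximal term `(τ / 2) ‖l_n - z_n‖²` for the centroids `z`. -/
noncomputable def proxCost (G : GridModel D H) (lam : H → ℝ) (τ : ℝ) (z : D → H → ℝ) (n : D)
    (l δ : D → H → ℝ) : ℝ :=
  G.penCost lam n l δ + τ / 2 * ∑ h, (l n h - z n h) ^ 2

/-- `(l, δ)` is a Nash equilibrium of the reformulated game with the proximal term. -/
def IsProxEquilibrium (G : GridModel D H) (lam : H → ℝ) (τ : ℝ) (z l δ : D → H → ℝ) : Prop :=
  ∀ n, IsUserSaddle (G.proxCost lam τ z) G.Ω n l δ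

/-- `(u, x)` is a run of the distributed asynchronous best-response algorithm in the loads and the
errors for the reformulated game with the proximal term. -/
def IsProxAsyncRun (G : GridModel D H) (lam : H → ℝ) (τ : ℝ) (z : D → H → ℝ)
    (s : AsyncSchedule D) (u x : ℕ → D → H → ℝ) : Prop :=
  ∀ i n,
    (i ∈ s.upd n →
      IsUserSaddle (G.proxCost lam τ z) G.Ω n
        (Function.update (fun k => u (s.time n k i) k) n (u (i + 1) n))
        (Function.update (fun k => x (s.time n k i) k) n (x (i + 1) n))) ∧
    (i ∉ s.upd n → u (i + 1) n = u i n ∧ x (i + 1) n = x i n)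

/-- The double-loop best-response algorithm with proximal parameter `τ` reaches `(l, δ)`. Inner
loop: for all feasible centroids `z` the game with the proximal term has a unique equilibrium, and
the asynchronous best-response algorithm for it can be run and converges to that equilibrium, for
every schedule and every feasible start. Outer loop: if the centroids are repeatedly replaced by the
loads of that equilibrium, then loads and errors converge to `(l, δ)`. -/
def ProxAsyncReaches (G : GridModel D H) (lam : H → ℝ) (τ : ℝ) (l δ : D → H → ℝ) : Prop :=
  (∀ z : D → H → ℝ, (∀ n, z n ∈ G.Ω n) →
    ∃ lz δz : D → H → ℝ, G.IsProxEquilibrium lam τ z lz δz ∧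
      (∀ l' δ' : D → H → ℝ, G.IsProxEquilibrium lam τ z l' δ' → l' = lz ∧ δ' = δz) ∧
      ∀ (s : AsyncSchedule D) (u₀ x₀ : D → H → ℝ), (∀ n, u₀ n ∈ G.Ω n) →
        (∃ u x, u 0 = u₀ ∧ x 0 = x₀ ∧ G.IsProxAsyncRun lam τ z s u x) ∧
        ∀ u x, u 0 = u₀ → x 0 = x₀ → G.IsProxAsyncRun lam τ z s u x →
          Tendsto u atTop (𝓝 lz) ∧ Tendsto x atTop (𝓝 δz)) ∧
  ∀ z ε : ℕ → D → H → ℝ, (∀ n, z 0 n ∈ G.Ω n) →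
    (∀ j, G.IsProxEquilibrium lam τ (z j) (z (j + 1)) (ε (j + 1))) →
    Tendsto z atTop (𝓝 l) ∧ Tendsto ε atTop (𝓝 δ)

end GridModel

/-!
Write `c = 2 (λ_h - β)` and `N = |D|`. All costs are quadratic, so saddle points are characterized by
first-order conditions (`GridModel.isUserSaddle_iff`): in every slot
`c δ_n = K (L + Δ + l_n + δ_n)`, and the loads solve a variational inequality for the marginal costs
`K (L + Δ + l_n + δ_n)`. For `c ≠ K (N + 1)` the first condition determines the errors
(`errResponse`), and turns the marginal cost into `a L + b l_n` with coefficients `a`, `b` that do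
not depend on the user. This is a gradient field.

*Existence.* For fixed multipliers, a minimizer of the potential over the feasible loads is
an equilibrium, although the potential need not be convex; no fixed point theorem is needed
(`exists_solvesLoadVI`). To satisfy the complementarity problem too, `α c + a(c) L² + b(c) ∑ l_n²`
(up to a factor, the dual function of the maximization over the errors) is minimized jointly over
the loads and over `c` in an interval inside `(K (N + 1), ∞)`. Its derivative in `c` is the slack
`α - ∑ δ_n²`, up to a positive factor, which is negative at the left and positive at the right end
of the interval, since `L > 0`; thus the constraint is active at the minimizer
(`GridModel.exists_isPenEquilibrium_ncp`). Compactness holds since the equilibrium conditions are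
closed and since `4 (λ_h - β)² α = ∑ (K (L + Δ + l_n + δ_n))²` bounds the multipliers. As the
constraints are active, every such solution is a variational solution of the robust game
(`GridModel.IsPenEquilibrium.isVariationalSolution`).

*Large multipliers.* For `c > K (N + 1)` one has `a, b > 0`, so that the variational inequality is
strongly monotone: equilibria are unique and the proximal point iteration converges
(`SolvesLoadVI.unique`, `SolvesLoadVI.tendsto_proximal`). The worst case over the errors has the same
first-order expansion as the cost at the maximizing errors, so min-max solutions are saddle points.
The best response in the errors is a contraction in the maximum norm with factor
`K (N - 1) / (c - 2 K) < 1`, and asynchronous iterations of such maps converge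
(`AsyncSchedule.tendsto_zero`). With the proximal term, the best-response loads move by `O(1 / τ)`, so
that in a maximum norm that gives the loads a large weight the joint best response is a contraction
too, once `τ` is large (`GridModel.exists_prox_contraction`).
-/

set_option linter.unusedSectionVars false

/-! ### Quadratic inequalities on a half-line and on the line -/

theorem linear_coeff_nonneg {a b : ℝ} (h : ∀ t : ℝ, 0 < t → t ≤ 1 → 0 ≤ t * a + t ^ 2 * b) :
    0 ≤ a := by
  by_contra! ha
  have hb : 0 < |b| + 1 := by positivity
  set t := min 1 (-a / (2 * (|b| + 1))) with ht
  have ht0 : 0 < t := lt_min one_pos (div_pos (by linarith) (by linarith))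
  have h1 := h t ht0 (min_le_left _ _)
  have h2 : t * (2 * (|b| + 1)) ≤ -a := (le_div_iff₀ (by linarith)).1 (min_le_right _ _)
  have h3 : 0 ≤ a + t * b := by
    have : 0 ≤ t * (a + t * b) := by nlinarith
    exact nonneg_of_mul_nonneg_right this ht0
  nlinarith [le_abs_self b]

theorem linear_coeff_eq_zero {a b : ℝ} (h : ∀ t : ℝ, t * a + t ^ 2 * b ≤ 0) : a = 0 := by
  apply le_antisymm
  · have := linear_coeff_nonneg (a := -a) (b := -b) fun t _ _ => by linarith [h t]
    linarith
  · exact linear_coeff_nonneg (b := -b) fun t _ _ => by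
      have := h (-t)
      nlinarith

/-! ### Totally asynchronous iterations -/

/-- Asynchronous convergence theorem for errors measured in a (weighted) maximum norm: if an update
shrinks every common bound on the errors of the information it uses by a factor `θ < 1`, then the
errors of all users tend to zero, whatever the schedule is. -/
theorem AsyncSchedule.tendsto_zero {D : Type*} [Finite D] (s : AsyncSchedule D) {θ : ℝ}
    (hθ0 : 0 ≤ θ) (hθ1 : θ < 1) (err : ℕ → D → ℝ) (h0 : ∀ i n, 0 ≤ err i n)
    (hupd : ∀ i n, i ∈ s.upd n → ∀ B, (∀ k, err (s.time n k i) k ≤ B) → err (i + 1) n ≤ θ * B)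
    (hkeep : ∀ i n, i ∉ s.upd n → err (i + 1) n = err i n) (n : D) :
    Tendsto (fun i => err i n) atTop (𝓝 0) := by
  classical
  have := Fintype.ofFinite D
  obtain ⟨R, hR⟩ : ∃ R, ∀ k, err 0 k ≤ R := by
    obtain ⟨R, hR⟩ := (Set.finite_range (err 0)).bddAbove
    exact ⟨R, fun k => hR ⟨k, rfl⟩⟩
  have hR0 : 0 ≤ R := (h0 0 n).trans (hR n)
  have hbase : ∀ i k, err i k ≤ R := by
    intro i
    induction i using Nat.strong_induction_on with
    | _ i ih =>
      intro k
      rcases i with _ | i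
      · exact hR k
      by_cases hk : i ∈ s.upd k
      · refine (hupd i k hk R fun j => ih _ (Nat.lt_succ_of_le (s.time_le k j i)) j).trans ?_
        nlinarith
      · rw [hkeep i k hk]
        exact ih i (Nat.lt_succ_self i) k
  have hstep : ∀ j : ℕ, ∃ N, ∀ i, N ≤ i → ∀ k, err i k ≤ θ ^ j * R := by
    intro j
    induction j with
    | zero => exact ⟨0, fun i _ k => by simpa using hbase i k⟩
    | succ j ih =>
      obtain ⟨N, hN⟩ := ih
      -- beyond `M k`, user `k` no longer uses information older than `N`
      have h1 : ∀ k, ∃ M, ∀ i ∈ s.upd k, M ≤ i → ∀ m, N ≤ s.time k m i := by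
        intro k
        choose M hM using fun m => s.time_tendsto k m N
        refine ⟨Finset.univ.sup M, fun i hi hMi m => hM m i hi ?_⟩
        exact (Finset.le_sup (Finset.mem_univ m)).trans hMi
      choose M hM using h1
      choose U hU hMU using fun k => (s.upd_infinite k).exists_gt (M k)
      have h2 : ∀ k i, U k + 1 ≤ i → err i k ≤ θ ^ (j + 1) * R := by
        intro k i hi
        have hup : ∀ i ∈ s.upd k, U k ≤ i → err (i + 1) k ≤ θ ^ (j + 1) * R := by
          intro i hi hUi
          rw [pow_succ', mul_assoc]
          exact hupd i k hi _ fun m => hN _ (hM k i hi ((hMU k).le.trans hUi) m) m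
        induction i, hi using Nat.le_induction with
        | base => exact hup _ (hU k) le_rfl
        | succ i hi ih =>
          by_cases hk : i ∈ s.upd k
          · exact hup i hk (by omega)
          · rw [hkeep i k hk]
            exact ih
      refine ⟨Finset.univ.sup fun k => U k + 1, fun i hi k => h2 k i ?_⟩
      exact (Finset.le_sup (f := fun k => U k + 1) (Finset.mem_univ k)).trans hi
  rw [Metric.tendsto_atTop]
  intro ε hε
  have hlim : Tendsto (fun j => θ ^ j * R) atTop (𝓝 0) := by
    simpa using (tendsto_pow_atTop_nhds_zero_of_lt_one hθ0 hθ1).mul_const R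
  obtain ⟨j, hj⟩ := (hlim.eventually (gt_mem_nhds hε)).exists
  obtain ⟨N, hN⟩ := hstep j
  refine ⟨N, fun i hi => ?_⟩
  rw [Real.dist_eq, sub_zero, abs_of_nonneg (h0 i n)]
  exact (hN i hi n).trans_lt hj

/-- An asynchronous iteration of given update maps can be run from every starting point. -/
theorem AsyncSchedule.exists_run {D X : Type*} (s : AsyncSchedule D) (T : D → (D → X) → X)
    (x₀ : D → X) :
    ∃ x : ℕ → D → X, x 0 = x₀ ∧ ∀ i n,
      (i ∈ s.upd n → x (i + 1) n = T n fun k => x (s.time n k i) k) ∧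
      (i ∉ s.upd n → x (i + 1) n = x i n) := by
  classical
  let step : ℕ → (ℕ → D → X) → D → X := fun i y n =>
    if i ∈ s.upd n then T n fun k => y (s.time n k i) k else y i n
  -- `hist i` records the states up to time `i`
  let hist : ℕ → ℕ → D → X := fun i =>
    Nat.rec (fun _ => x₀) (fun i y => Function.update y (i + 1) (step i y)) i
  have hsucc : ∀ i, hist (i + 1) = Function.update (hist i) (i + 1) (step i (hist i)) :=
    fun _ => rfl
  have hle : ∀ j i, j ≤ i → hist i j = hist j j := by
    intro j i hij
    induction i, hij using Nat.le_induction with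
    | base => rfl
    | succ i hi ih => rw [hsucc, Function.update_of_ne (by omega), ih]
  refine ⟨fun i => hist i i, rfl, fun i n => ?_⟩
  have h1 : hist (i + 1) (i + 1) = step i (hist i) := by rw [hsucc, Function.update_self]
  refine ⟨fun hi => ?_, fun hi => ?_⟩
  · simp only [h1, step, if_pos hi]
    congr 1
    funext k
    rw [hle _ i (s.time_le n k i)]
  · simp only [h1, step, if_neg hi]

theorem sum_comp_update {D H : Type*} [Fintype D] [DecidableEq D] (f : D → ℝ → ℝ)
    (l : D → H → ℝ) (n : D) (m : H → ℝ) (h : H) :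
    ∑ k, f k (Function.update l n m k h) = ∑ k, f k (l k h) + (f n (m h) - f n (l n h)) := by
  have h1 : ∑ k, (f k (Function.update l n m k h) - f k (l k h)) = f n (m h) - f n (l n h) := by
    rw [Finset.sum_eq_single n (fun k _ hk => by simp [hk]) (by simp)]
    simp
  rw [Finset.sum_sub_distrib] at h1
  linarith

theorem sum_update_apply {D H : Type*} [Fintype D] [DecidableEq D] (l : D → H → ℝ) (n : D)
    (m : H → ℝ) (h : H) :
    ∑ k, Function.update l n m k h = ∑ k, l k h + (m h - l n h) :=
  sum_comp_update (fun _ t => t) l n m h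

/-- A minimizer over a convex set of a quadratic function with gradient `g` at `x` solves the
variational inequality; the quadratic part may be indefinite. -/
theorem variational_inequality_of_quadratic {H : Type*} [Fintype H] {C : Set (H → ℝ)}
    (hC : Convex ℝ C) {x : H → ℝ} (hx : x ∈ C) (g q : H → ℝ)
    (hmin : ∀ m ∈ C, 0 ≤ ∑ h, g h * (m h - x h) + ∑ h, q h * (m h - x h) ^ 2) :
    ∀ m ∈ C, 0 ≤ ∑ h, g h * (m h - x h) := by
  intro m hm
  refine linear_coeff_nonneg (b := ∑ h, q h * (m h - x h) ^ 2) fun t ht0 ht1 => ?_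
  have h1 := hmin _ (hC.add_smul_sub_mem hx hm ⟨ht0.le, ht1⟩)
  simp only [Pi.add_apply, Pi.smul_apply, Pi.sub_apply, smul_eq_mul, add_sub_cancel_left] at h1
  rw [Finset.mul_sum, Finset.mul_sum]
  refine h1.trans_eq ?_
  congr 1 <;> exact Finset.sum_congr rfl fun h _ => by ring

namespace GridModel

variable {D H : Type*} [Fintype D] [DecidableEq D] [Fintype H] [DecidableEq H]

/-- The marginal energy cost `K_h (L(h) + Δ(h) + l_n(h) + δ_n(h))` of user `n`, where `L` and `Δ`
are the total load and the total error: the derivative of the energy cost of user `n` with respect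
to its load, and also with respect to its error. -/
def marginal (G : GridModel D H) (l δ : D → H → ℝ) (n : D) (h : H) : ℝ :=
  G.K h * (∑ k, l k h + ∑ k, δ k h + l n h + δ n h)

/-! ### Saddle points of one user -/

theorem proxCost_update_load (G : GridModel D H) (lam : H → ℝ) (τ : ℝ) (z : D → H → ℝ) (n : D)
    (l δ : D → H → ℝ) (m : H → ℝ) :
    G.proxCost lam τ z n (Function.update l n m) δ = G.proxCost lam τ z n l δ +
      ∑ h, (G.marginal l δ n h + τ * (l n h - z n h)) * (m h - l n h) +
      ∑ h, (G.K h + τ / 2) * (m h - l n h) ^ 2 := by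
  simp only [proxCost, penCost, marginal, sum_update_apply, Function.update_self, Finset.mul_sum,
    ← Finset.sum_add_distrib]
  exact Finset.sum_congr rfl fun h _ => by
    simp only [Finset.sum_add_distrib, ← Finset.mul_sum]; ring

theorem proxCost_update_error (G : GridModel D H) (lam : H → ℝ) (τ : ℝ) (z : D → H → ℝ) (n : D)
    (l δ : D → H → ℝ) (d : H → ℝ) :
    G.proxCost lam τ z n l (Function.update δ n d) = G.proxCost lam τ z n l δ +
      ∑ h, (G.marginal l δ n h - 2 * (lam h - G.β) * δ n h) * (d h - δ n h) +
      ∑ h, (G.K h + G.β - lam h) * (d h - δ n h) ^ 2 := by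
  simp only [proxCost, penCost, marginal, sum_update_apply, Function.update_self, Finset.mul_sum,
    ← Finset.sum_add_distrib]
  exact Finset.sum_congr rfl fun h _ => by
    simp only [Finset.sum_add_distrib, ← Finset.mul_sum]; ring

theorem proxCost_zero (G : GridModel D H) (lam : H → ℝ) (z : D → H → ℝ) :
    G.proxCost lam 0 z = G.penCost lam := by
  funext n l δ
  simp [proxCost]

/-- The errors of user `n` maximize its cost iff they satisfy the first-order condition. -/
theorem forall_update_error_le_iff (G : GridModel D H) {lam : H → ℝ}
    (hlam : ∀ h, G.K h + G.β ≤ lam h) (τ : ℝ) (z : D → H → ℝ) (n : D) (l δ : D → H → ℝ) :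
    (∀ d, G.proxCost lam τ z n l (Function.update δ n d) ≤ G.proxCost lam τ z n l δ) ↔
      ∀ h, 2 * (lam h - G.β) * δ n h = G.marginal l δ n h := by
  simp only [proxCost_update_error]
  constructor
  · intro hd h
    have h1 := linear_coeff_eq_zero (a := G.marginal l δ n h - 2 * (lam h - G.β) * δ n h)
      (b := G.K h + G.β - lam h) fun t => by
        have h2 := hd (Function.update (δ n) h (δ n h + t))
        rw [Finset.sum_eq_single h (fun k _ hk => by simp [hk]) (by simp),
          Finset.sum_eq_single h (fun k _ hk => by simp [hk]) (by simp)] at h2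
        simp only [Function.update_self] at h2
        linarith
    linarith
  · intro hf d
    have h1 : ∑ h, (G.marginal l δ n h - 2 * (lam h - G.β) * δ n h) * (d h - δ n h) = 0 :=
      Finset.sum_eq_zero fun h _ => by rw [hf h]; ring
    have h2 : ∑ h, (G.K h + G.β - lam h) * (d h - δ n h) ^ 2 ≤ 0 :=
      Finset.sum_nonpos fun h _ =>
        mul_nonpos_of_nonpos_of_nonneg (by linarith [hlam h]) (sq_nonneg _)
    linarith

/-- The load of user `n` minimizes its cost iff it solves the variational inequality of user
`n`. -/
theorem forall_update_load_le_iff (G : GridModel D H) (lam : H → ℝ) {τ : ℝ} (hτ : 0 ≤ τ)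
    (z : D → H → ℝ) {n : D} {l : D → H → ℝ} (δ : D → H → ℝ) (hl : l n ∈ G.Ω n) :
    (∀ m ∈ G.Ω n, G.proxCost lam τ z n l δ ≤ G.proxCost lam τ z n (Function.update l n m) δ) ↔
      ∀ m ∈ G.Ω n, 0 ≤ ∑ h, (G.marginal l δ n h + τ * (l n h - z n h)) * (m h - l n h) := by
  simp only [proxCost_update_load]
  constructor
  · intro hm
    exact variational_inequality_of_quadratic (G.Ω_convex n) hl _ (fun h => G.K h + τ / 2)
      fun m hmΩ => by linarith [hm m hmΩ]
  · intro hm m hmΩ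
    have h1 : 0 ≤ ∑ h, (G.K h + τ / 2) * (m h - l n h) ^ 2 :=
      Finset.sum_nonneg fun h _ => by have := G.K_pos h; positivity
    linarith [hm m hmΩ]

/-- First-order characterization of the saddle points of user `n`. -/
theorem isUserSaddle_iff (G : GridModel D H) {lam : H → ℝ} (hlam : ∀ h, G.K h + G.β ≤ lam h)
    {τ : ℝ} (hτ : 0 ≤ τ) (z : D → H → ℝ) (n : D) (l δ : D → H → ℝ) :
    IsUserSaddle (G.proxCost lam τ z) G.Ω n l δ ↔
      l n ∈ G.Ω n ∧ (∀ h, 2 * (lam h - G.β) * δ n h = G.marginal l δ n h) ∧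
      ∀ m ∈ G.Ω n, 0 ≤ ∑ h, (G.marginal l δ n h + τ * (l n h - z n h)) * (m h - l n h) := by
  constructor
  · rintro ⟨h1, h2, h3⟩
    exact ⟨h1, (G.forall_update_error_le_iff hlam τ z n l δ).1 h3,
      (G.forall_update_load_le_iff lam hτ z δ h1).1 h2⟩
  · rintro ⟨h1, h2, h3⟩
    exact ⟨h1, (G.forall_update_load_le_iff lam hτ z δ h1).2 h3,
      (G.forall_update_error_le_iff hlam τ z n l δ).2 h2⟩

end GridModel

/-! ### The equilibrium errors as a function of the loads -/

/-- The errors of the users in one slot with cost coefficient `K` at which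
`c δ_n = K (L + Δ + l_n + δ_n)` holds for all users `n`, as a function of their loads `v`. The
quotients are meaningful for `c ≠ K` and `c ≠ K (|D| + 1)`. -/
noncomputable def errResponse {D : Type*} [Fintype D] (K c : ℝ) (v : D → ℝ) (n : D) : ℝ :=
  K * (c / (c - K * (Fintype.card D + 1)) * ∑ k, v k + v n) / (c - K)

/-- The coefficient of the total load in the marginal cost at the equilibrium errors, meaningful for
`c ≠ K` and `c ≠ K (|D| + 1)`. -/
noncomputable def totalCoeff (D : Type*) [Fintype D] (K c : ℝ) : ℝ :=
  c ^ 2 * K / ((c - K) * (c - K * (Fintype.card D + 1)))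

/-- The coefficient of the user's own load in the marginal cost at the equilibrium errors, meaningful
for `c ≠ K`. -/
noncomputable def ownCoeff (K c : ℝ) : ℝ := c * K / (c - K)

section slot

variable {D : Type*} [Fintype D]

theorem sum_errResponse {K c : ℝ} (h1 : c - K ≠ 0) (h2 : c - K * (Fintype.card D + 1) ≠ 0)
    (v : D → ℝ) :
    ∑ n, errResponse K c v n =
      K * (Fintype.card D + 1) * (∑ k, v k) / (c - K * (Fintype.card D + 1)) := by
  simp only [errResponse]
  rw [← Finset.sum_div, ← Finset.mul_sum, Finset.sum_add_distrib, Finset.sum_const,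
    Finset.card_univ, nsmul_eq_mul]
  field_simp
  ring

/-- The sum of the equations over the users determines the total error, and then each equation the
error of one user. -/
theorem forall_eq_errResponse_iff {K c : ℝ} (h1 : c - K ≠ 0)
    (h2 : c - K * (Fintype.card D + 1) ≠ 0) (v e : D → ℝ) :
    (∀ n, c * e n = K * (∑ k, v k + ∑ k, e k + v n + e n)) ↔ ∀ n, e n = errResponse K c v n := by
  constructor
  · intro h
    have hs : c * ∑ n, e n = ∑ n, K * (∑ k, v k + ∑ k, e k + v n + e n) := by
      rw [Finset.mul_sum]
      exact Finset.sum_congr rfl fun n _ => h n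
    rw [← Finset.mul_sum] at hs
    simp only [Finset.sum_add_distrib, Finset.sum_const, Finset.card_univ, nsmul_eq_mul] at hs
    have hΔ : ∑ n, e n =
        K * (Fintype.card D + 1) * (∑ k, v k) / (c - K * (Fintype.card D + 1)) := by
      rw [eq_div_iff h2]
      linarith
    intro n
    have := h n
    rw [hΔ] at this
    rw [errResponse, eq_div_iff h1]
    field_simp at this ⊢
    linarith
  · intro h n
    rw [show ∑ k, e k = ∑ k, errResponse K c v k from Finset.sum_congr rfl fun k _ => h k,
      sum_errResponse h1 h2, h n, errResponse]
    field_simp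
    ring

theorem mul_errResponse {K c : ℝ} (h1 : c - K ≠ 0) (h2 : c - K * (Fintype.card D + 1) ≠ 0)
    (v : D → ℝ) (n : D) :
    c * errResponse K c v n = totalCoeff D K c * ∑ k, v k + ownCoeff K c * v n := by
  rw [errResponse, totalCoeff, ownCoeff]
  field_simp

end slot

namespace GridModel

variable {D H : Type*} [Fintype D] [DecidableEq D] [Fintype H] [DecidableEq H]

/-- The equilibrium errors at the loads `l`, for the multipliers `lam`. -/
noncomputable def errors (G : GridModel D H) (lam : H → ℝ) (l : D → H → ℝ) : D → H → ℝ :=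
  fun n h => errResponse (G.K h) (2 * (lam h - G.β)) (fun k => l k h) n

theorem continuous_errors (G : GridModel D H) (lam : H → ℝ) : Continuous (G.errors lam) := by
  unfold errors errResponse
  fun_prop

end GridModel

/-! ### The variational inequality of the loads -/

section loads

variable {D H : Type*} [Fintype D] [DecidableEq D] [Fintype H] [DecidableEq H]

/-- The feasible loads `l` solve the variational inequality of the map
`l ↦ a L + b l_n + τ (l_n - z_n)`, where `L` is the total load. -/
def SolvesLoadVI (Ω : D → Set (H → ℝ)) (a b : H → ℝ) (τ : ℝ) (z l : D → H → ℝ) : Prop :=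
  (∀ n, l n ∈ Ω n) ∧ ∀ n, ∀ m ∈ Ω n,
    0 ≤ ∑ h, (a h * ∑ k, l k h + b h * l n h + τ * (l n h - z n h)) * (m h - l n h)

/-- A potential of the map `l ↦ a L + b l_n + τ (l_n - z_n)`. -/
noncomputable def loadPotential (a b : H → ℝ) (τ : ℝ) (z l : D → H → ℝ) : ℝ :=
  ∑ h, (a h / 2 * (∑ k, l k h) ^ 2 + b h / 2 * ∑ k, l k h ^ 2 +
    τ / 2 * ∑ k, (l k h - z k h) ^ 2)

theorem loadPotential_update (a b : H → ℝ) (τ : ℝ) (z l : D → H → ℝ) (n : D) (m : H → ℝ) :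
    loadPotential a b τ z (Function.update l n m) = loadPotential a b τ z l +
      ∑ h, (a h * ∑ k, l k h + b h * l n h + τ * (l n h - z n h)) * (m h - l n h) +
      ∑ h, (a h + b h + τ) / 2 * (m h - l n h) ^ 2 := by
  have h1 := fun h => sum_comp_update (fun k t => t ^ 2) l n m h
  have h2 := fun h => sum_comp_update (fun k t => (t - z k h) ^ 2) l n m h
  simp only [loadPotential, sum_update_apply, h1, h2, ← Finset.sum_add_distrib]
  exact Finset.sum_congr rfl fun h _ => by ring

theorem SolvesLoadVI.of_minimizer {Ω : D → Set (H → ℝ)} (hconv : ∀ n, Convex ℝ (Ω n))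
    {a b : H → ℝ} {τ : ℝ} {z l : D → H → ℝ} (hl : ∀ n, l n ∈ Ω n)
    (hmin : ∀ l' : D → H → ℝ, (∀ n, l' n ∈ Ω n) →
      loadPotential a b τ z l ≤ loadPotential a b τ z l') :
    SolvesLoadVI Ω a b τ z l := by
  refine ⟨hl, fun n => variational_inequality_of_quadratic (hconv n) (hl n) _
    (fun h => (a h + b h + τ) / 2) fun m hm => ?_⟩
  have h1 := hmin (Function.update l n m) fun k => by
    by_cases hk : k = n
    · subst hk; simpa using hm
    · simpa [hk] using hl k
  rw [loadPotential_update] at h1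
  linarith

theorem exists_solvesLoadVI {Ω : D → Set (H → ℝ)} (hne : ∀ n, (Ω n).Nonempty)
    (hcomp : ∀ n, IsCompact (Ω n)) (hconv : ∀ n, Convex ℝ (Ω n)) (a b : H → ℝ) (τ : ℝ)
    (z : D → H → ℝ) : ∃ l, SolvesLoadVI Ω a b τ z l := by
  have hcont : Continuous (loadPotential a b τ z) := by unfold loadPotential; fun_prop
  obtain ⟨l, hl, hmin⟩ := (isCompact_univ_pi hcomp).exists_isMinOn
    (Set.univ_pi_nonempty_iff.2 hne) hcont.continuousOn
  exact ⟨l, SolvesLoadVI.of_minimizer hconv (fun n => hl n trivial)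
    fun l' hl' => hmin fun n _ => hl' n⟩

/-- The estimate of strong monotonicity for two solutions of the variational inequality with different
centroids. -/
theorem SolvesLoadVI.sum_sq_le {Ω : D → Set (H → ℝ)} {a b : H → ℝ} (ha : ∀ h, 0 ≤ a h) {τ : ℝ}
    {z l z' l' : D → H → ℝ} (hl : SolvesLoadVI Ω a b τ z l) (hl' : SolvesLoadVI Ω a b τ z' l') :
    ∑ n, ∑ h, (b h + τ) * (l n h - l' n h) ^ 2 ≤
      τ * ∑ n, ∑ h, (z n h - z' n h) * (l n h - l' n h) := by
  have h1 : ∀ n, ∑ h, ((b h + τ) * (l n h - l' n h) ^ 2 +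
      a h * (∑ k, l k h - ∑ k, l' k h) * (l n h - l' n h) -
      τ * ((z n h - z' n h) * (l n h - l' n h))) ≤ 0 := fun n => by
    have h2 := add_nonneg (hl.2 n _ (hl'.1 n)) (hl'.2 n _ (hl.1 n))
    rw [← Finset.sum_add_distrib] at h2
    rw [← neg_nonneg, ← Finset.sum_neg_distrib]
    exact h2.trans_eq (Finset.sum_congr rfl fun h _ => by ring)
  have h2 : ∑ n, ∑ h, a h * (∑ k, l k h - ∑ k, l' k h) * (l n h - l' n h) =
      ∑ h, a h * (∑ k, l k h - ∑ k, l' k h) ^ 2 := by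
    rw [Finset.sum_comm]
    refine Finset.sum_congr rfl fun h _ => ?_
    rw [← Finset.mul_sum, Finset.sum_sub_distrib]
    ring
  have h3 : 0 ≤ ∑ h, a h * (∑ k, l k h - ∑ k, l' k h) ^ 2 :=
    Finset.sum_nonneg fun h _ => mul_nonneg (ha h) (sq_nonneg _)
  have h4 := Finset.sum_nonpos fun n (_ : n ∈ Finset.univ) => h1 n
  simp only [Finset.sum_sub_distrib, Finset.sum_add_distrib, ← Finset.mul_sum] at h2 h3 h4 ⊢
  linarith

theorem eq_of_sum_sq_le_zero {x y : D → H → ℝ} {w : H → ℝ} (hw : ∀ h, 0 < w h)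
    (hxy : ∑ n, ∑ h, w h * (x n h - y n h) ^ 2 ≤ 0) : x = y := by
  have h1 : ∀ n h, 0 ≤ w h * (x n h - y n h) ^ 2 :=
    fun n h => mul_nonneg (hw h).le (sq_nonneg _)
  have h2 := (Finset.sum_eq_zero_iff_of_nonneg fun n _ =>
    Finset.sum_nonneg fun h _ => h1 n h).1
      (hxy.antisymm (Finset.sum_nonneg fun n _ => Finset.sum_nonneg fun h _ => h1 n h))
  funext n h
  have h3 := (Finset.sum_eq_zero_iff_of_nonneg fun h _ => h1 n h).1 (h2 n (Finset.mem_univ n)) h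
    (Finset.mem_univ h)
  have h4 := (mul_eq_zero.1 h3).resolve_left (hw h).ne'
  exact sub_eq_zero.1 (pow_eq_zero_iff two_ne_zero |>.1 h4)

theorem SolvesLoadVI.unique {Ω : D → Set (H → ℝ)} {a b : H → ℝ} (ha : ∀ h, 0 ≤ a h)
    (hb : ∀ h, 0 < b h) {τ : ℝ} (hτ : 0 ≤ τ) {z l l' : D → H → ℝ}
    (hl : SolvesLoadVI Ω a b τ z l) (hl' : SolvesLoadVI Ω a b τ z l') : l = l' := by
  refine eq_of_sum_sq_le_zero (w := fun h => b h + τ) (fun h => by linarith [hb h]) ?_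
  simpa using hl.sum_sq_le ha hl'

/-- The proximal point iteration converges to the solution of the variational inequality. -/
theorem SolvesLoadVI.tendsto_proximal {Ω : D → Set (H → ℝ)} {a b : H → ℝ}
    (ha : ∀ h, 0 ≤ a h) (hb : ∀ h, 0 < b h) {τ : ℝ} (hτ : 0 < τ) {z₀ l : D → H → ℝ}
    (hl : SolvesLoadVI Ω a b 0 z₀ l) {z : ℕ → D → H → ℝ}
    (hz : ∀ j, SolvesLoadVI Ω a b τ (z j) (z (j + 1))) : Tendsto z atTop (𝓝 l) := by
  have hl' : SolvesLoadVI Ω a b τ l l := by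
    refine ⟨hl.1, fun n m hm => ?_⟩
    simpa using hl.2 n m hm
  -- a common positive lower bound of the coefficients `b h`
  obtain ⟨c, hc0, hc⟩ : ∃ c, 0 < c ∧ ∀ h, c ≤ b h := by
    rcases isEmpty_or_nonempty H with hH | hH
    · exact ⟨1, one_pos, fun h => hH.elim h⟩
    · obtain ⟨h₀, hh₀⟩ := Finite.exists_min b
      exact ⟨b h₀, hb h₀, hh₀⟩
  let E : ℕ → ℝ := fun j => ∑ n, ∑ h, (z j n h - l n h) ^ 2
  have hE0 : ∀ j, 0 ≤ E j := fun j =>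
    Finset.sum_nonneg fun n _ => Finset.sum_nonneg fun h _ => sq_nonneg _
  have hstep : ∀ j, E (j + 1) ≤ τ / (2 * c + τ) * E j := by
    intro j
    have h1 := (hz j).sum_sq_le ha hl'
    have h2 : (c + τ) * E (j + 1) ≤
        ∑ n, ∑ h, (b h + τ) * (z (j + 1) n h - l n h) ^ 2 := by
      simp only [E, Finset.mul_sum]
      gcongr with n _ h _
      exact hc h
    have h3 : ∑ n, ∑ h, (z j n h - l n h) * (z (j + 1) n h - l n h) ≤
        (E j + E (j + 1)) / 2 := by
      simp only [E]
      rw [← Finset.sum_add_distrib, Finset.sum_div]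
      refine Finset.sum_le_sum fun n _ => ?_
      rw [← Finset.sum_add_distrib, Finset.sum_div]
      refine Finset.sum_le_sum fun h _ => ?_
      nlinarith [sq_nonneg ((z j n h - l n h) - (z (j + 1) n h - l n h))]
    rw [div_mul_eq_mul_div, le_div_iff₀ (by positivity)]
    nlinarith [mul_le_mul_of_nonneg_left h3 hτ.le]
  have hE : Tendsto E atTop (𝓝 0) := by
    have hρ : τ / (2 * c + τ) < 1 := by
      rw [div_lt_one (by positivity)]; linarith
    have hpow : ∀ j, E j ≤ (τ / (2 * c + τ)) ^ j * E 0 := by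
      intro j
      induction j with
      | zero => simp
      | succ j ih =>
        calc E (j + 1) ≤ τ / (2 * c + τ) * E j := hstep j
          _ ≤ τ / (2 * c + τ) * ((τ / (2 * c + τ)) ^ j * E 0) := by gcongr
          _ = _ := by ring
    refine squeeze_zero hE0 hpow ?_
    simpa using (tendsto_pow_atTop_nhds_zero_of_lt_one (by positivity) hρ).mul_const (E 0)
  rw [tendsto_pi_nhds]
  intro n
  rw [tendsto_pi_nhds]
  intro h
  rw [tendsto_iff_norm_sub_tendsto_zero]
  refine squeeze_zero (fun _ => norm_nonneg _) (fun j => ?_)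
    (by simpa using (Real.continuous_sqrt.tendsto 0).comp hE)
  simp only [Function.comp_apply, Real.norm_eq_abs]
  refine Real.abs_le_sqrt ?_
  calc (z j n h - l n h) ^ 2 ≤ ∑ h, (z j n h - l n h) ^ 2 :=
        Finset.single_le_sum (f := fun h => (z j n h - l n h) ^ 2)
          (fun _ _ => sq_nonneg _) (Finset.mem_univ h)
    _ ≤ E j := Finset.single_le_sum (f := fun n => ∑ h, (z j n h - l n h) ^ 2)
          (fun _ _ => Finset.sum_nonneg fun _ _ => sq_nonneg _) (Finset.mem_univ n)

end loads

namespace GridModel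

variable {D H : Type*} [Fintype D] [DecidableEq D] [Fintype H] [DecidableEq H]

/-! ### Equilibria for fixed multipliers -/

theorem two_mul_sub_sub_pos (G : GridModel D H) {lam : H → ℝ} (hlam : ∀ h, G.K h + G.β ≤ lam h)
    (h : H) : 0 < 2 * (lam h - G.β) - G.K h := by
  linarith [G.K_pos h, hlam h]

theorem forall_mul_eq_marginal_iff (G : GridModel D H) {lam : H → ℝ}
    (hlam : ∀ h, G.K h + G.β ≤ lam h)
    (hne : ∀ h, 2 * (lam h - G.β) - G.K h * (Fintype.card D + 1) ≠ 0) (l δ : D → H → ℝ) :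
    (∀ n h, 2 * (lam h - G.β) * δ n h = G.marginal l δ n h) ↔ δ = G.errors lam l := by
  have h1 := fun h => forall_eq_errResponse_iff (G.two_mul_sub_sub_pos hlam h).ne' (hne h)
    (fun k => l k h) (fun k => δ k h)
  rw [forall_comm]
  simp only [marginal, h1]
  rw [forall_comm]
  simp only [funext_iff, errors]

/-- Elimination of the errors: away from the degenerate multipliers, the loads of the equilibria are
the solutions of a variational inequality, and the errors are a function of the loads. -/
theorem isProxEquilibrium_iff (G : GridModel D H) {lam : H → ℝ}
    (hlam : ∀ h, G.K h + G.β ≤ lam h)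
    (hne : ∀ h, 2 * (lam h - G.β) - G.K h * (Fintype.card D + 1) ≠ 0) {τ : ℝ} (hτ : 0 ≤ τ)
    (z l δ : D → H → ℝ) :
    G.IsProxEquilibrium lam τ z l δ ↔ δ = G.errors lam l ∧
      SolvesLoadVI G.Ω (fun h => totalCoeff D (G.K h) (2 * (lam h - G.β)))
        (fun h => ownCoeff (G.K h) (2 * (lam h - G.β))) τ z l := by
  have hfoc := G.forall_mul_eq_marginal_iff hlam hne l
  have hmarg : ∀ n h, G.marginal l (G.errors lam l) n h =
      totalCoeff D (G.K h) (2 * (lam h - G.β)) * ∑ k, l k h +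
        ownCoeff (G.K h) (2 * (lam h - G.β)) * l n h := fun n h => by
    rw [← (hfoc _).2 rfl n h]
    exact mul_errResponse (G.two_mul_sub_sub_pos hlam h).ne' (hne h) _ n
  simp only [IsProxEquilibrium, G.isUserSaddle_iff hlam hτ z, SolvesLoadVI, forall_and, hfoc]
  constructor
  · rintro ⟨h1, rfl, h3⟩
    simp only [hmarg] at h3
    exact ⟨rfl, h1, h3⟩
  · rintro ⟨rfl, h1, h3⟩
    simp only [hmarg]
    exact ⟨h1, trivial, h3⟩

theorem isPenEquilibrium_iff_prox (G : GridModel D H) (lam : H → ℝ) (z l δ : D → H → ℝ) :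
    G.IsPenEquilibrium lam l δ ↔ G.IsProxEquilibrium lam 0 z l δ := by
  rw [IsPenEquilibrium, IsProxEquilibrium, proxCost_zero]

theorem exists_isProxEquilibrium (G : GridModel D H) {lam : H → ℝ}
    (hlam : ∀ h, G.K h + G.β ≤ lam h)
    (hne : ∀ h, 2 * (lam h - G.β) - G.K h * (Fintype.card D + 1) ≠ 0) {τ : ℝ} (hτ : 0 ≤ τ)
    (z : D → H → ℝ) : ∃ l δ, G.IsProxEquilibrium lam τ z l δ := by
  obtain ⟨l, hl⟩ := exists_solvesLoadVI G.Ω_nonempty G.Ω_compact G.Ω_convex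
    (fun h => totalCoeff D (G.K h) (2 * (lam h - G.β)))
    (fun h => ownCoeff (G.K h) (2 * (lam h - G.β))) τ z
  exact ⟨l, _, (G.isProxEquilibrium_iff hlam hne hτ z l _).2 ⟨rfl, hl⟩⟩

/-- The graph of the equilibrium correspondence is closed, also with variable multipliers. -/
theorem isClosed_setOf_isPenEquilibrium (G : GridModel D H) :
    IsClosed {z : (D → H → ℝ) × (D → H → ℝ) × (H → ℝ) | G.IsPenEquilibrium z.2.2 z.1 z.2.1} := by
  simp only [IsPenEquilibrium, IsUserSaddle, Set.ofPred_forall, Set.ofPred_and]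
  have hcont : ∀ (n : D) (f g : (D → H → ℝ) × (D → H → ℝ) × (H → ℝ) → D → H → ℝ),
      Continuous f → Continuous g → Continuous fun z => G.penCost z.2.2 n (f z) (g z) := by
    intro n f g hf hg
    unfold penCost
    fun_prop
  refine isClosed_iInter fun n => IsClosed.inter ?_ (IsClosed.inter ?_ ?_)
  · exact (G.Ω_compact n).isClosed.preimage (by fun_prop)
  · refine isClosed_iInter fun m => isClosed_iInter fun _ => isClosed_le ?_ ?_
    · exact hcont n _ _ (by fun_prop) (by fun_prop)
    · exact hcont n _ _ (continuous_fst.update n continuous_const) (by fun_prop)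
  · refine isClosed_iInter fun d => isClosed_le ?_ ?_
    · exact hcont n _ _ (by fun_prop) ((continuous_fst.comp continuous_snd).update n
        continuous_const)
    · exact hcont n _ _ (by fun_prop) (by fun_prop)

theorem isCompact_setOf_isPenEquilibrium (G : GridModel D H) {lam : H → ℝ}
    (hlam : ∀ h, G.K h + G.β ≤ lam h)
    (hne : ∀ h, 2 * (lam h - G.β) - G.K h * (Fintype.card D + 1) ≠ 0) :
    IsCompact {z : (D → H → ℝ) × (D → H → ℝ) | G.IsPenEquilibrium lam z.1 z.2} := by
  have hcomp := (isCompact_univ_pi G.Ω_compact).image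
    (continuous_id.prodMk (G.continuous_errors lam))
  refine hcomp.of_isClosed_subset
    (G.isClosed_setOf_isPenEquilibrium.preimage
      (f := fun z : (D → H → ℝ) × (D → H → ℝ) => (z.1, z.2, lam)) (by fun_prop)) ?_
  rintro ⟨l, δ⟩ hz
  obtain ⟨h1, h2⟩ := (G.isProxEquilibrium_iff hlam hne le_rfl 0 l δ).1
    ((G.isPenEquilibrium_iff_prox lam 0 l δ).1 hz)
  exact ⟨l, fun n _ => h2.1 n, by simp [h1]⟩

end GridModel

/-! ### Choosing the multiplier of a slot -/

section slot

variable {D : Type*} [Fintype D]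

/-- For `c = 2 (λ - β) > K (|D| + 1)`, the dual function of one slot with loads `v`, up to the
constant `α β`: the term `α λ` of the constraint, plus the maximum over the errors of the potential
of the slot with the penalty of the errors. -/
noncomputable def slotDual (K α : ℝ) (v : D → ℝ) (c : ℝ) : ℝ :=
  α * c / 2 + totalCoeff D K c / 2 * (∑ k, v k) ^ 2 + ownCoeff K c / 2 * ∑ k, v k ^ 2

theorem sum_errResponse_sq (K c : ℝ) (v : D → ℝ) :
    ∑ n, errResponse K c v n ^ 2 = K ^ 2 / (c - K) ^ 2 *
      (Fintype.card D * (c / (c - K * (Fintype.card D + 1))) ^ 2 * (∑ k, v k) ^ 2 +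
        2 * (c / (c - K * (Fintype.card D + 1))) * (∑ k, v k) ^ 2 + ∑ k, v k ^ 2) := by
  set s := c / (c - K * (Fintype.card D + 1))
  set L := ∑ k, v k with hL
  have h1 : ∀ n, errResponse K c v n ^ 2 =
      K ^ 2 / (c - K) ^ 2 * (s ^ 2 * L ^ 2 + 2 * s * L * v n + v n ^ 2) := fun n => by
    rw [errResponse, div_pow]
    ring
  rw [Finset.sum_congr rfl fun n _ => h1 n, ← Finset.mul_sum]
  simp only [Finset.sum_add_distrib, ← Finset.mul_sum, Finset.sum_const, Finset.card_univ,
    nsmul_eq_mul, ← hL]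
  ring

/-- The derivative of the dual function is the slack of the constraint `∑ n, δ_n ^ 2 ≤ α`. -/
theorem hasDerivAt_slotDual {K c : ℝ} (α : ℝ) (h1 : c - K ≠ 0)
    (h2 : c - K * (Fintype.card D + 1) ≠ 0) (v : D → ℝ) :
    HasDerivAt (slotDual K α v) ((α - ∑ n, errResponse K c v n ^ 2) / 2) c := by
  have hid := hasDerivAt_id' c
  have ha := ((hid.pow 2).mul_const K).div
    ((hid.sub_const K).mul (hid.sub_const (K * (Fintype.card D + 1)))) (mul_ne_zero h1 h2)
  have hb := (hid.mul_const K).div (hid.sub_const K) h1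
  have := (((hid.const_mul α).div_const 2).add ((ha.div_const 2).mul_const ((∑ k, v k) ^ 2))).add
    ((hb.div_const 2).mul_const (∑ k, v k ^ 2))
  refine HasDerivAt.congr_deriv (f := slotDual K α v) this ?_
  rw [sum_errResponse_sq]
  simp only [Pi.pow_apply, Pi.mul_apply]
  field_simp
  ring

/-- Between suitable bounds on `c`, the errors change from too large to too small, uniformly in the
loads. -/
theorem exists_slot_bounds (D : Type*) [Fintype D] {K α r B : ℝ} (hK : 0 < K) (hα : 0 < α)
    (hr : 0 < r) :
    ∃ lo hi, K * (Fintype.card D + 1) < lo ∧ lo ≤ hi ∧ ∀ v : D → ℝ, r ≤ ∑ n, v n →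
      ∑ n, v n ≤ B → (∀ n, |v n| ≤ B) →
        α < ∑ n, errResponse K lo v n ^ 2 ∧ ∑ n, errResponse K hi v n ^ 2 < α := by
  set N := (Fintype.card D : ℝ) with hN
  have hN0 : 0 ≤ N := Nat.cast_nonneg _
  have hk : 0 < K * (N + 1) := by positivity
  set X := K * (N + 1) * r with hX
  have hX0 : 0 < X := by positivity
  have hX1 : 0 < X ^ 2 / (2 * (N * α + 1)) := by positivity
  obtain ⟨y, hy0, hy1, hyX⟩ : ∃ y : ℝ, 0 < y ∧ y ≤ 1 ∧ y ≤ X ^ 2 / (2 * (N * α + 1)) :=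
    ⟨min 1 (X ^ 2 / (2 * (N * α + 1))), lt_min one_pos hX1, min_le_left _ _, min_le_right _ _⟩
  -- at `K (N + 1) + y` the total error is at least `X / y`, and at `K (N + 1) + w` each error is at
  -- most `3 K B / w` in absolute value
  set w := 1 + K * (N + 1) + N * (3 * K * B) ^ 2 / α with hw
  have hw1 : 1 + K * (N + 1) ≤ w := le_add_of_nonneg_right (by positivity)
  refine ⟨K * (N + 1) + y, K * (N + 1) + w, by linarith, by linarith, fun v hrv hvB hv => ⟨?_, ?_⟩⟩
  · have hc1 : K * (N + 1) + y - K ≠ 0 := by nlinarith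
    have hsum := sum_errResponse hc1 (by simpa [← hN] using hy0.ne') v
    rw [← hN, add_sub_cancel_left] at hsum
    have hcs := sq_sum_le_card_mul_sum_sq (s := Finset.univ)
      (f := fun n => errResponse K (K * (N + 1) + y) v n)
    rw [hsum, div_pow, div_le_iff₀ (by positivity), Finset.card_univ, ← hN] at hcs
    by_contra! hle
    have h1 : X ^ 2 ≤ (K * (N + 1) * ∑ k, v k) ^ 2 := by
      rw [hX]; gcongr
    have h2 : N * ∑ n, errResponse K (K * (N + 1) + y) v n ^ 2 * y ^ 2 ≤ N * α * y := by
      have h3 : (∑ n, errResponse K (K * (N + 1) + y) v n ^ 2) * y ^ 2 ≤ α * y := by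
        have : y ^ 2 ≤ y := by nlinarith
        gcongr
      rw [← Finset.sum_mul]
      nlinarith
    rw [le_div_iff₀ (by positivity)] at hyX
    rw [← Finset.sum_mul, ← mul_assoc] at h2
    nlinarith
  · have hw0 : 0 < w := by linarith
    have hs0 : 0 ≤ (K * (N + 1) + w) / w := by positivity
    have hs2 : (K * (N + 1) + w) / w ≤ 2 := by rw [div_le_iff₀ hw0]; linarith
    have hcw : w ≤ K * (N + 1) + w - K := by nlinarith
    have hB : 0 ≤ B := hr.le.trans (hrv.trans hvB)
    have h1 : ∀ n, errResponse K (K * (N + 1) + w) v n ^ 2 ≤ (3 * K * B / w) ^ 2 := fun n => by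
      refine sq_le_sq' ?_ ?_ <;> rw [errResponse, ← hN, add_sub_cancel_left]
      · rw [← neg_div, div_le_div_iff₀ hw0 (by linarith)]
        have h2 : -(3 * B) ≤ (K * (N + 1) + w) / w * ∑ k, v k + v n := by
          have := mul_nonneg hs0 (hr.le.trans hrv)
          linarith [neg_abs_le (v n), hv n]
        have h3 := mul_le_mul_of_nonneg_left h2 (mul_pos hK hw0).le
        have h4 := mul_le_mul_of_nonneg_left hcw (by positivity : 0 ≤ 3 * K * B)
        nlinarith
      · have h2 : (K * (N + 1) + w) / w * ∑ k, v k + v n ≤ 3 * B := by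
          have := mul_le_mul hs2 hvB (hr.le.trans hrv) (by norm_num)
          linarith [le_abs_self (v n), hv n]
        calc _ ≤ K * (3 * B) / (K * (N + 1) + w - K) := by
              have : 0 ≤ K * (N + 1) + w - K := by linarith
              gcongr
          _ ≤ K * (3 * B) / w := by gcongr
          _ = _ := by ring
    calc ∑ n, errResponse K (K * (N + 1) + w) v n ^ 2
        ≤ ∑ _n : D, (3 * K * B / w) ^ 2 := Finset.sum_le_sum fun n _ => h1 n
      _ = N * (3 * K * B) ^ 2 / w ^ 2 := by
        rw [Finset.sum_const, Finset.card_univ, nsmul_eq_mul, ← hN, div_pow, mul_div_assoc]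
      _ < α := by
        rw [div_lt_iff₀ (by positivity)]
        have h2 : N * (3 * K * B) ^ 2 / α < w := by linarith
        rw [div_lt_iff₀ hα] at h2
        have h3 : w ≤ w ^ 2 := by nlinarith
        nlinarith

/-- A minimizer of the dual function over an interval at whose ends the derivative has the signs
`-` and `+` is interior, so that the constraint is active there. -/
theorem sum_errResponse_sq_eq {K α lo hi c : ℝ} (hK : 0 < K) {v : D → ℝ}
    (hlo : K * (Fintype.card D + 1) < lo) (hc : c ∈ Set.Icc lo hi)
    (hvlo : α < ∑ n, errResponse K lo v n ^ 2) (hvhi : ∑ n, errResponse K hi v n ^ 2 < α)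
    (hmin : ∀ t ∈ Set.Icc lo hi, slotDual K α v c ≤ slotDual K α v t) :
    ∑ n, errResponse K c v n ^ 2 = α := by
  have hN0 : (0 : ℝ) ≤ Fintype.card D := Nat.cast_nonneg _
  have hcK : c - K ≠ 0 := by nlinarith [hc.1]
  have hd := hasDerivAt_slotDual α hcK (by linarith [hc.1]) v
  have hloc : IsLocalMinOn (slotDual K α v) (Set.Icc lo hi) c :=
    Filter.eventually_of_mem self_mem_nhdsWithin hmin
  have hvar : ∀ t ∈ Set.Icc lo hi,
      0 ≤ (t - c) * ((α - ∑ n, errResponse K c v n ^ 2) / 2) := by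
    intro t ht
    have := hloc.hasFDerivWithinAt_nonneg hd.hasDerivWithinAt.hasFDerivWithinAt
      (sub_mem_posTangentConeAt_of_segment_subset ((convex_Icc lo hi).segment_subset hc ht))
    simpa using this
  have hlohi : lo ≤ hi := hc.1.trans hc.2
  have h1 : lo < c := hc.1.lt_of_ne fun h => by
    subst h
    have h2 := hvar hi ⟨hlohi, le_rfl⟩
    rcases hlohi.eq_or_lt with h3 | h3
    · rw [h3] at hvlo; linarith
    · nlinarith
  have h2 : c < hi := hc.2.lt_of_ne fun h => by
    subst h
    nlinarith [hvar lo ⟨le_rfl, hlohi⟩]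
  have h3 := hvar lo ⟨le_rfl, hlohi⟩
  have h4 := hvar hi ⟨hlohi, le_rfl⟩
  apply le_antisymm <;> nlinarith

theorem continuousOn_slotDual {K lo hi : ℝ} (hK : 0 < K) (α : ℝ)
    (hlo : K * (Fintype.card D + 1) < lo) :
    ContinuousOn (fun p : (D → ℝ) × ℝ => slotDual K α p.1 p.2)
      (Set.univ ×ˢ Set.Icc lo hi) := by
  have hN0 : (0 : ℝ) ≤ Fintype.card D := Nat.cast_nonneg _
  have h1 : ∀ p ∈ (Set.univ : Set (D → ℝ)) ×ˢ Set.Icc lo hi, p.2 - K ≠ 0 := fun p hp => by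
    nlinarith [hp.2.1]
  have h2 : ∀ p ∈ (Set.univ : Set (D → ℝ)) ×ˢ Set.Icc lo hi,
      (p.2 - K) * (p.2 - K * (Fintype.card D + 1)) ≠ 0 := fun p hp =>
    mul_ne_zero (h1 p hp) (by linarith [hp.2.1])
  unfold slotDual totalCoeff ownCoeff
  fun_prop (disch := assumption)

end slot

namespace GridModel

variable {D H : Type*} [Fintype D] [DecidableEq D] [Fintype H] [DecidableEq H]

/-! ### Equilibria with the complementarity problem -/

/-- There is a user if there is a slot, since the total load of the slot is positive. -/
theorem one_le_card (G : GridModel D H) (h : H) : (1 : ℝ) ≤ Fintype.card D := by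
  rcases isEmpty_or_nonempty D with hD | hD
  · have := G.load_pos (fun n => hD.elim n) (fun n => hD.elim n) h
    simp at this
  · exact_mod_cast Fintype.card_pos

/-- Bounds on the feasible loads in one slot. -/
theorem exists_load_bounds (G : GridModel D H) (h : H) :
    ∃ r B : ℝ, 0 < r ∧ ∀ l : D → H → ℝ, (∀ n, l n ∈ G.Ω n) →
      r ≤ ∑ n, l n h ∧ ∑ n, l n h ≤ B ∧ ∀ n, |l n h| ≤ B := by
  have hcomp := isCompact_univ_pi G.Ω_compact
  obtain ⟨l₀, hl₀, hmin⟩ := hcomp.exists_isMinOn (Set.univ_pi_nonempty_iff.2 G.Ω_nonempty)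
    (f := fun l => ∑ n, l n h) (by fun_prop)
  obtain ⟨R, hR⟩ := hcomp.exists_bound_of_continuousOn (f := fun l => ∑ n, |l n h|) (by fun_prop)
  refine ⟨∑ n, l₀ n h, R, G.load_pos l₀ (fun n => hl₀ n trivial) h, fun l hl => ?_⟩
  have h1 : ∑ n, |l n h| ≤ R := (le_abs_self _).trans (hR l fun n _ => hl n)
  refine ⟨hmin fun n _ => hl n, ?_, fun n => ?_⟩
  · exact (Finset.sum_le_sum fun n _ => le_abs_self _).trans h1
  · exact (Finset.single_le_sum (f := fun n => |l n h|) (fun _ _ => abs_nonneg _)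
      (Finset.mem_univ n)).trans h1

/-- Minimizing the dual function jointly over the loads and the multipliers yields an equilibrium at
which all error constraints are active. -/
theorem exists_isPenEquilibrium_ncp (G : GridModel D H) :
    ∃ l δ lam, G.IsPenEquilibrium lam l δ ∧ G.NCP lam δ := by
  choose r B hr hB using G.exists_load_bounds
  choose lo hi hlo hlohi hbd using
    fun h => exists_slot_bounds D (B := B h) (G.K_pos h) (G.α_pos h) (hr h)
  let W : (D → H → ℝ) × (H → ℝ) → ℝ := fun p =>
    ∑ h, slotDual (G.K h) (G.α h) (fun k => p.1 k h) (p.2 h)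
  have hcont : ContinuousOn W (Set.univ.pi G.Ω ×ˢ Set.univ.pi fun h => Set.Icc (lo h) (hi h)) := by
    refine continuousOn_finsetSum _ fun h _ => ?_
    refine (continuousOn_slotDual (hi := hi h) (G.K_pos h) (G.α h) (hlo h)).comp
      (f := fun p : (D → H → ℝ) × (H → ℝ) => (fun k => p.1 k h, p.2 h)) ?_ ?_
    · fun_prop
    · exact fun p hp => ⟨trivial, hp.2 h trivial⟩
  obtain ⟨⟨l, c⟩, hlc, hmin⟩ := ((isCompact_univ_pi G.Ω_compact).prod
    (isCompact_univ_pi fun h => isCompact_Icc (a := lo h) (b := hi h))).exists_isMinOn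
      ((Set.univ_pi_nonempty_iff.2 G.Ω_nonempty).prod
        (Set.univ_pi_nonempty_iff.2 fun h => Set.nonempty_Icc.2 (hlohi h))) hcont
  have hl : ∀ n, l n ∈ G.Ω n := fun n => hlc.1 n trivial
  have hc : ∀ h, c h ∈ Set.Icc (lo h) (hi h) := fun h => hlc.2 h trivial
  have hck : ∀ h, G.K h * (Fintype.card D + 1) < c h := fun h => (hlo h).trans_le (hc h).1
  -- the minimum over the multiplier of one slot is interior
  have hactive : ∀ h, ∑ n, errResponse (G.K h) (c h) (fun k => l k h) n ^ 2 = G.α h := by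
    intro h
    obtain ⟨hb1, hb2, hb3⟩ := hB h l hl
    obtain ⟨h1, h2⟩ := hbd h (fun k => l k h) hb1 hb2 hb3
    refine sum_errResponse_sq_eq (G.K_pos h) (hlo h) (hc h) h1 h2 fun t ht => ?_
    have h3 : W (l, c) ≤ W (l, Function.update c h t) := hmin ⟨hlc.1, fun h' _ => by
      by_cases hh : h' = h
      · subst hh; simpa using ht
      · simpa [hh] using hc h'⟩
    have h4 : ∑ h', (slotDual (G.K h') (G.α h') (fun k => l k h') (Function.update c h t h') -
        slotDual (G.K h') (G.α h') (fun k => l k h') (c h')) =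
        slotDual (G.K h) (G.α h) (fun k => l k h) t -
          slotDual (G.K h) (G.α h) (fun k => l k h) (c h) := by
      rw [Finset.sum_eq_single h (fun k _ hk => by simp [hk]) (by simp)]
      simp
    rw [Finset.sum_sub_distrib] at h4
    simp only [W] at h3
    linarith
  have hVI : SolvesLoadVI G.Ω (fun h => totalCoeff D (G.K h) (c h))
      (fun h => ownCoeff (G.K h) (c h)) 0 0 l := by
    have hpot : ∀ l', W (l', c) = ∑ h, G.α h * c h / 2 +
        loadPotential (fun h => totalCoeff D (G.K h) (c h)) (fun h => ownCoeff (G.K h) (c h))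
          0 0 l' := fun l' => by
      simp only [W, slotDual, loadPotential, ← Finset.sum_add_distrib]
      exact Finset.sum_congr rfl fun h _ => by ring
    refine SolvesLoadVI.of_minimizer G.Ω_convex hl fun l' hl' => ?_
    have h1 : W (l, c) ≤ W (l', c) := hmin ⟨fun n _ => hl' n, hlc.2⟩
    rw [hpot, hpot] at h1
    linarith
  have hlam : ∀ h, 2 * ((c h / 2 + G.β) - G.β) = c h := fun h => by ring
  have hKlam : ∀ h, G.K h + G.β ≤ c h / 2 + G.β := fun h => by
    have := mul_le_mul_of_nonneg_left (G.one_le_card h) (G.K_pos h).le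
    linarith [hck h]
  refine ⟨l, G.errors (fun h => c h / 2 + G.β) l, fun h => c h / 2 + G.β, ?_, fun h => ?_⟩
  · rw [G.isPenEquilibrium_iff_prox _ 0, G.isProxEquilibrium_iff hKlam
      (fun h => by rw [hlam]; linarith [hck h]) le_rfl]
    simp only [hlam]
    exact ⟨trivial, hVI⟩
  · have h1 : ∑ k, G.errors (fun h => c h / 2 + G.β) l k h ^ 2 = G.α h := by
      simp only [errors, hlam]
      exact hactive h
    refine ⟨by linarith [G.K_pos h, G.β_nonneg], hKlam h, ?_, ?_⟩ <;> rw [h1] <;> simp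

theorem NCP.sum_sq_eq {G : GridModel D H} {lam : H → ℝ} {δ : D → H → ℝ} (hδ : G.NCP lam δ)
    (h : H) : ∑ k, δ k h ^ 2 = G.α h := by
  obtain ⟨h1, h2, -, h3⟩ := hδ h
  have := (mul_eq_zero.1 h3).resolve_left (by linarith)
  linarith

/-- First-order conditions at an equilibrium of the penalized game. -/
theorem IsPenEquilibrium.two_mul_sub_mul_eq {G : GridModel D H} {lam : H → ℝ}
    (hlam : ∀ h, G.K h + G.β ≤ lam h) {l δ : D → H → ℝ} (hE : G.IsPenEquilibrium lam l δ)
    (n : D) (h : H) : 2 * (lam h - G.β) * δ n h = G.marginal l δ n h :=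
  ((G.isUserSaddle_iff hlam le_rfl 0 n l δ).1
    (((G.isPenEquilibrium_iff_prox lam 0 l δ).1 hE) n)).2.1 h

theorem isCompact_setOf_isPenEquilibrium_ncp (G : GridModel D H) :
    IsCompact {z : (D → H → ℝ) × (D → H → ℝ) × (H → ℝ) |
      G.IsPenEquilibrium z.2.2 z.1 z.2.1 ∧ G.NCP z.2.2 z.2.1} := by
  -- the errors and the loads are bounded
  have hE : ∀ δ : D → H → ℝ, (∀ h, ∑ k, δ k h ^ 2 = G.α h) →
      δ ∈ Set.univ.pi fun _ : D => Set.univ.pi fun h =>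
        Set.Icc (-√(G.α h)) (√(G.α h)) := by
    intro δ hδ n _ h _
    refine abs_le.1 (Real.abs_le_sqrt ?_)
    rw [← hδ h]
    exact Finset.single_le_sum (f := fun k => δ k h ^ 2) (fun _ _ => sq_nonneg _)
      (Finset.mem_univ n)
  have hC := (isCompact_univ_pi G.Ω_compact).prod (isCompact_univ_pi fun _ : D =>
    isCompact_univ_pi fun h => isCompact_Icc (a := -√(G.α h)) (b := √(G.α h)))
  -- the first-order conditions and the active constraints bound the multipliers
  have hR : ∀ h, ∃ R, ∀ p ∈ (Set.univ.pi G.Ω) ×ˢ (Set.univ.pi fun _ : D => Set.univ.pi fun h =>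
      Set.Icc (-√(G.α h)) (√(G.α h))),
      ‖∑ n, (G.marginal p.1 p.2 n h) ^ 2‖ ≤ R := fun h =>
    hC.exists_bound_of_continuousOn (by unfold marginal; fun_prop)
  choose R hR using hR
  have hK := hC.prod (isCompact_univ_pi fun h =>
    isCompact_Icc (a := 0) (b := G.β + (1 + R h / G.α h)))
  refine (hK.image (f := fun p => (p.1.1, p.1.2, p.2)) (by fun_prop)).of_isClosed_subset ?_ ?_
  · have hN : IsClosed {z : (D → H → ℝ) × (D → H → ℝ) × (H → ℝ) | G.NCP z.2.2 z.2.1} := ?_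
    · exact G.isClosed_setOf_isPenEquilibrium.inter hN
    simp only [NCP, Set.ofPred_forall, Set.ofPred_and]
    refine isClosed_iInter fun h => isClosed_const.inter (IsClosed.inter ?_ (IsClosed.inter ?_ ?_))
    · exact isClosed_le (by fun_prop) (by fun_prop)
    · exact isClosed_le (by fun_prop) (by fun_prop)
    · exact isClosed_eq (by fun_prop) (by fun_prop)
  · rintro ⟨l, δ, lam⟩ ⟨hEq, hN⟩
    have hlam : ∀ h, G.K h + G.β ≤ lam h := fun h => (hN h).2.1
    have hl : (l, δ) ∈ (Set.univ.pi G.Ω) ×ˢ (Set.univ.pi fun _ : D => Set.univ.pi fun h =>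
        Set.Icc (-√(G.α h)) (√(G.α h))) := ⟨fun n _ => (hEq n).1, hE δ hN.sum_sq_eq⟩
    refine ⟨((l, δ), lam), ⟨hl, fun h _ => ⟨?_, ?_⟩⟩, rfl⟩
    · have := hlam h
      linarith [G.K_pos h, G.β_nonneg]
    · have h1 := (le_abs_self _).trans (hR h _ hl)
      have h2 : ∑ n, G.marginal l δ n h ^ 2 = 4 * (lam h - G.β) ^ 2 * G.α h := by
        rw [← hN.sum_sq_eq h, Finset.mul_sum]
        refine Finset.sum_congr rfl fun n _ => ?_
        rw [← hEq.two_mul_sub_mul_eq hlam]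
        ring
      simp only [h2] at h1
      have h3 : (lam h - G.β) ^ 2 * 4 ≤ R h / G.α h := by
        rw [le_div_iff₀ (G.α_pos h)]
        linarith
      nlinarith [sq_nonneg (lam h - G.β - 1)]

/-! ### Variational solutions of the robust game -/

theorem cost_eq_penCost (G : GridModel D H) (lam : H → ℝ) (n : D) (l δ : D → H → ℝ) :
    G.cost n l δ = G.penCost lam n l δ + ∑ h, lam h * δ n h ^ 2 := by
  simp only [cost, penCost, Finset.mul_sum, ← Finset.sum_add_distrib]
  exact Finset.sum_congr rfl fun h _ => by ring

/-- If `δ_n` attains the maximum over its region and `l_n` minimizes the cost at these errors, then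
`l_n` minimizes the worst case. -/
theorem worstCase_le_of_saddle {f : D → (D → H → ℝ) → (D → H → ℝ) → ℝ} {S : Set (H → ℝ)}
    {n : D} {l l' δ : D → H → ℝ} (hS : δ n ∈ S)
    (hmax : ∀ d ∈ S, f n l (Function.update δ n d) ≤ f n l δ) (hmin : f n l δ ≤ f n l' δ) :
    worstCase f S n l δ ≤ worstCase f S n l' δ := by
  refine (iSup₂_le fun d hd => EReal.coe_le_coe_iff.2 ((hmax d hd).trans hmin)).trans ?_
  have := le_iSup₂ (f := fun d (_ : d ∈ S) => (f n l' (Function.update δ n d) : EReal)) (δ n) hS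
  rwa [Function.update_eq_self] at this

theorem IsPenEquilibrium.isRobustEquilibrium {G : GridModel D H} {lam : H → ℝ}
    {l δ : D → H → ℝ} (hE : G.IsPenEquilibrium lam l δ) (hN : G.NCP lam δ) :
    G.IsRobustEquilibrium l δ := by
  intro n
  obtain ⟨h1, h2, h3⟩ := hE n
  have hS : δ n ∈ G.errorSlice n δ := fun h => by
    rw [Function.update_eq_self]
    exact (hN.sum_sq_eq h).le
  have hmax : ∀ d ∈ G.errorSlice n δ, G.cost n l (Function.update δ n d) ≤ G.cost n l δ := by
    intro d hd
    rw [G.cost_eq_penCost lam, G.cost_eq_penCost lam]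
    refine add_le_add (h3 d) (Finset.sum_le_sum fun h _ => ?_)
    -- the constraint is active at `δ`, so no admissible error of user `n` is larger
    have h4 := hd h
    have h5 := sum_comp_update (fun _ t => t ^ 2) δ n d h
    have h6 := hN.sum_sq_eq h
    rw [Function.update_self]
    have hlam : 0 ≤ lam h := by linarith [(hN h).1, (hN h).2.1]
    exact mul_le_mul_of_nonneg_left (by linarith) hlam
  refine ⟨h1, hS, hmax, fun m hm => worstCase_le_of_saddle hS hmax ?_⟩
  rw [G.cost_eq_penCost lam, G.cost_eq_penCost lam]
  linarith [h2 m hm]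

theorem hasDerivAt_penCost_setEntry (G : GridModel D H) (lam : H → ℝ) (l δ : D → H → ℝ) (n : D)
    (h : H) :
    HasDerivAt (fun t => G.penCost lam n l (setEntry δ n h t))
      (G.marginal l δ n h - 2 * (lam h - G.β) * δ n h) (δ n h) := by
  have h1 : ∀ t, G.penCost lam n l (setEntry δ n h t) = G.penCost lam n l δ +
      (G.marginal l δ n h - 2 * (lam h - G.β) * δ n h) * (t - δ n h) +
      (G.K h + G.β - lam h) * (t - δ n h) ^ 2 := by
    intro t
    have h2 := G.proxCost_update_error lam 0 0 n l δ (Function.update (δ n) h t)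
    rw [Finset.sum_eq_single h (fun k _ hk => by simp [hk]) (by simp),
      Finset.sum_eq_single h (fun k _ hk => by simp [hk]) (by simp)] at h2
    simpa only [proxCost_zero, Function.update_self, setEntry] using h2
  simp only [h1]
  have hid := (hasDerivAt_id' (δ n h)).sub_const (δ n h)
  exact (((hid.const_mul (G.marginal l δ n h - 2 * (lam h - G.β) * δ n h)).const_add
    (G.penCost lam n l δ)).add ((hid.pow 2).const_mul (G.K h + G.β - lam h))).congr_deriv
      (by simp)

theorem deriv_cost_setEntry (G : GridModel D H) (l δ : D → H → ℝ) (n : D) (h : H) :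
    deriv (fun t => G.cost n l (setEntry δ n h t)) (δ n h) =
      G.marginal l δ n h + 2 * G.β * δ n h := by
  have h1 := (G.hasDerivAt_penCost_setEntry 0 l δ n h).deriv
  have h2 : ∀ t, G.cost n l (setEntry δ n h t) = G.penCost 0 n l (setEntry δ n h t) := fun t => by
    simp [G.cost_eq_penCost 0]
  simp only [h2, h1, Pi.zero_apply]
  ring

theorem deriv_sum_sq_setEntry (δ : D → H → ℝ) (n : D) (h : H) (a : ℝ) :
    deriv (fun t => ∑ k, setEntry δ n h t k h ^ 2 - a) (δ n h) = 2 * δ n h := by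
  have h1 : ∀ t, ∑ k, setEntry δ n h t k h ^ 2 - a =
      t ^ 2 + (∑ k, δ k h ^ 2 - δ n h ^ 2 - a) := fun t => by
    have := sum_comp_update (fun _ t => t ^ 2) δ n (Function.update (δ n) h t) h
    rw [Function.update_self] at this
    rw [setEntry, this]
    ring
  simp only [h1]
  simp

theorem IsPenEquilibrium.isVariationalSolution {G : GridModel D H} {lam : H → ℝ}
    {l δ : D → H → ℝ} (hE : G.IsPenEquilibrium lam l δ) (hN : G.NCP lam δ) :
    G.IsVariationalSolution l δ := by
  have hlam : ∀ h, G.K h + G.β ≤ lam h := fun h => (hN h).2.1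
  refine ⟨hE.isRobustEquilibrium hN, lam, fun h => ?_, fun h => ?_, fun n h => ?_⟩
  · linarith [hlam h, (hN h).1]
  · rw [hN.sum_sq_eq h, sub_self, mul_zero]
  · rw [deriv_cost_setEntry, deriv_sum_sq_setEntry, ← hE.two_mul_sub_mul_eq hlam]
    ring

end GridModel

namespace GridModel

variable {D H : Type*} [Fintype D] [DecidableEq D] [Fintype H] [DecidableEq H]

/-! ### Strong monotonicity in the errors and the min-max formulation -/

theorem stronglyMonotoneInErrors (G : GridModel D H) {lam : H → ℝ}
    (hc : ∀ h, 0 < 2 * (lam h - G.β) - G.K h * (Fintype.card D + 1)) :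
    G.StronglyMonotoneInErrors lam := by
  obtain ⟨c, hc0, hcle⟩ :
      ∃ c, 0 < c ∧ ∀ h, c ≤ 2 * (lam h - G.β) - G.K h * (Fintype.card D + 1) := by
    rcases isEmpty_or_nonempty H with hH | hH
    · exact ⟨1, one_pos, fun h => hH.elim h⟩
    · obtain ⟨h₀, hh₀⟩ :=
        Finite.exists_min fun h => 2 * (lam h - G.β) - G.K h * (Fintype.card D + 1)
      exact ⟨_, hc h₀, hh₀⟩
  refine ⟨c, hc0, fun l _ δ ε => ?_⟩
  rw [Finset.sum_comm, Finset.sum_comm (s := Finset.univ (α := D)), Finset.mul_sum]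
  refine Finset.sum_le_sum fun h _ => ?_
  have hE : ∑ n, (δ n h - ε n h) = ∑ n, δ n h - ∑ n, ε n h := Finset.sum_sub_distrib ..
  have hcs := sq_sum_le_card_mul_sum_sq (s := Finset.univ) (f := fun n => δ n h - ε n h)
  rw [Finset.card_univ, hE] at hcs
  have h0 : 0 ≤ ∑ n, (δ n h - ε n h) ^ 2 := Finset.sum_nonneg fun _ _ => sq_nonneg _
  have h1 : ∀ n, (G.errorField lam l δ n h - G.errorField lam l ε n h) * (δ n h - ε n h) =
      (2 * (lam h - G.β) - G.K h) * (δ n h - ε n h) ^ 2 -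
        G.K h * (∑ n, δ n h - ∑ n, ε n h) * (δ n h - ε n h) := fun n => by
    simp only [errorField, (G.hasDerivAt_penCost_setEntry lam l _ n h).deriv, marginal]
    ring
  rw [Finset.sum_congr rfl fun n _ => h1 n, Finset.sum_sub_distrib, ← Finset.mul_sum,
    ← Finset.mul_sum, hE]
  nlinarith [mul_le_mul_of_nonneg_left hcs (G.K_pos h).le,
    mul_le_mul_of_nonneg_right (hcle h) h0]

theorem IsPenEquilibrium.isPenMinMaxEquilibrium {G : GridModel D H} {lam : H → ℝ}
    {l δ : D → H → ℝ} (hE : G.IsPenEquilibrium lam l δ) : G.IsPenMinMaxEquilibrium lam l δ :=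
  fun n => ⟨(hE n).1, trivial, fun d _ => (hE n).2.2 d, fun m hm =>
    worstCase_le_of_saddle trivial (fun d _ => (hE n).2.2 d) ((hE n).2.1 m hm)⟩

theorem marginal_update_load (G : GridModel D H) (l δ : D → H → ℝ) (n : D) (m : H → ℝ) (h : H) :
    G.marginal (Function.update l n m) δ n h =
      G.marginal l δ n h + 2 * G.K h * (m h - l n h) := by
  simp only [marginal, sum_update_apply, Function.update_self]
  ring

/-- If the costs are strictly concave in the errors, then the worst case has the same first-order
expansion in the load as the cost at the maximizing errors. A min-max solution thus solves the
variational inequality of the loads and is a saddle point. -/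
theorem IsPenMinMaxEquilibrium.isPenEquilibrium {G : GridModel D H} {lam : H → ℝ}
    (hlam : ∀ h, G.K h + G.β < lam h) {l δ : D → H → ℝ}
    (hE : G.IsPenMinMaxEquilibrium lam l δ) : G.IsPenEquilibrium lam l δ := by
  intro n
  obtain ⟨h1, -, h2, h3⟩ := hE n
  have hfoc := (G.forall_update_error_le_iff (fun h => (hlam h).le) 0 0 n l δ).1 fun d => by
    simpa only [proxCost_zero] using h2 d trivial
  rw [← G.proxCost_zero lam 0, G.isUserSaddle_iff (fun h => (hlam h).le) le_rfl]
  refine ⟨h1, hfoc, variational_inequality_of_quadratic (G.Ω_convex n) h1 _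
    (fun h => G.K h + G.K h ^ 2 / (lam h - G.K h - G.β)) fun m hm => ?_⟩
  have hlow : (G.penCost lam n l δ : EReal) ≤ worstCase (G.penCost lam) Set.univ n l δ := by
    have := le_iSup₂ (f := fun d (_ : d ∈ Set.univ) =>
      (G.penCost lam n l (Function.update δ n d) : EReal)) (δ n) trivial
    rwa [Function.update_eq_self] at this
  have hup : worstCase (G.penCost lam) Set.univ n (Function.update l n m) δ ≤
      (G.penCost lam n l δ + (∑ h, (G.marginal l δ n h + 0 * (l n h - (0 : D → H → ℝ) n h)) *
        (m h - l n h) + ∑ h, (G.K h + G.K h ^ 2 / (lam h - G.K h - G.β)) * (m h - l n h) ^ 2) :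
          ℝ) := by
    refine iSup₂_le fun d _ => EReal.coe_le_coe_iff.2 ?_
    have h4 := G.proxCost_update_error lam 0 0 n (Function.update l n m) δ d
    have h5 := G.proxCost_update_load lam 0 0 n l δ m
    rw [proxCost_zero] at h4 h5
    rw [h4, h5, add_assoc, add_assoc, add_assoc, ← Finset.sum_add_distrib,
      ← Finset.sum_add_distrib]
    refine add_le_add_right (add_le_add_right ?_ _) _
    refine Finset.sum_le_sum fun h _ => ?_
    have hs : 0 < lam h - G.K h - G.β := by linarith [hlam h]
    rw [marginal_update_load, ← hfoc h]
    -- complete the square in the error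
    have h6 : 0 ≤ (lam h - G.K h - G.β) *
        ((d h - δ n h) - G.K h * (m h - l n h) / (lam h - G.K h - G.β)) ^ 2 := by positivity
    have h7 : (lam h - G.K h - G.β) *
        ((d h - δ n h) - G.K h * (m h - l n h) / (lam h - G.K h - G.β)) ^ 2 =
        (lam h - G.K h - G.β) * (d h - δ n h) ^ 2 -
          2 * G.K h * (m h - l n h) * (d h - δ n h) +
          G.K h ^ 2 / (lam h - G.K h - G.β) * (m h - l n h) ^ 2 := by
      field_simp
      ring
    linarith
  have h4 := EReal.coe_le_coe_iff.1 ((hlow.trans (h3 m hm)).trans hup)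
  linarith

end GridModel

/-! ### Asynchronous best responses in the errors -/

theorem abs_sum_sub_le {D : Type*} [Fintype D] (w : D → ℝ) {B : ℝ} (hw : ∀ k, |w k| ≤ B)
    (n : D) : |∑ k, w k - w n| ≤ (Fintype.card D - 1) * B := by
  classical
  rw [← Finset.add_sum_erase _ _ (Finset.mem_univ n), add_sub_cancel_left]
  refine (Finset.abs_sum_le_sum_abs _ _).trans ((Finset.sum_le_sum fun k _ => hw k).trans_eq ?_)
  rw [Finset.sum_const, nsmul_eq_mul, Finset.card_erase_of_mem (Finset.mem_univ n),
    Finset.card_univ, Nat.cast_pred (Fintype.card_pos_iff.2 ⟨n⟩)]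

namespace GridModel

variable {D H : Type*} [Fintype D] [DecidableEq D] [Fintype H] [DecidableEq H]

/-- A best response in the errors is characterized by a linear equation. -/
theorem forall_update_le_update_iff (G : GridModel D H) {lam : H → ℝ}
    (hlam : ∀ h, G.K h + G.β ≤ lam h) (n : D) (l y : D → H → ℝ) (e : H → ℝ) :
    (∀ d, G.penCost lam n l (Function.update y n d) ≤ G.penCost lam n l (Function.update y n e)) ↔
      ∀ h, (2 * (lam h - G.β) - 2 * G.K h) * e h =
        G.K h * (∑ k, l k h + l n h + (∑ k, y k h - y n h)) := by
  have h1 := G.forall_update_error_le_iff hlam 0 0 n l (Function.update y n e)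
  simp only [proxCost_zero, Function.update_idem, marginal, sum_update_apply,
    Function.update_self] at h1
  rw [h1]
  refine forall_congr' fun h => ⟨fun h2 => by linarith, fun h2 => by linarith⟩

theorem isInnerEquilibrium_iff (G : GridModel D H) {lam : H → ℝ}
    (hlam : ∀ h, G.K h + G.β ≤ lam h)
    (hne : ∀ h, 2 * (lam h - G.β) - G.K h * (Fintype.card D + 1) ≠ 0) (l δ : D → H → ℝ) :
    G.IsInnerEquilibrium lam l δ ↔ δ = G.errors lam l := by
  have h1 := fun n => G.forall_update_error_le_iff hlam 0 0 n l δ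
  simp only [proxCost_zero] at h1
  simp only [IsInnerEquilibrium, h1, G.forall_mul_eq_marginal_iff hlam hne]

/-- Since there is a user, `K_h (|D| + 1) < 2 (λ_h - β)` makes the costs strictly concave in the
errors. -/
theorem K_add_β_lt (G : GridModel D H) {lam : H → ℝ}
    (hc : ∀ h, 0 < 2 * (lam h - G.β) - G.K h * (Fintype.card D + 1)) (h : H) :
    G.K h + G.β < lam h := by
  nlinarith [hc h, G.one_le_card h, G.K_pos h]

/-- The contraction factor of the best responses in the errors. -/
theorem exists_contraction_factor (G : GridModel D H) {lam : H → ℝ}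
    (hc : ∀ h, 0 < 2 * (lam h - G.β) - G.K h * (Fintype.card D + 1)) :
    ∃ θ : ℝ, 0 ≤ θ ∧ θ < 1 ∧
      ∀ h, G.K h * (Fintype.card D - 1) ≤ θ * (2 * (lam h - G.β) - 2 * G.K h) := by
  rcases isEmpty_or_nonempty H with hH | hH
  · exact ⟨0, le_rfl, one_pos, fun h => hH.elim h⟩
  have hpos : ∀ h, 0 < 2 * (lam h - G.β) - 2 * G.K h := fun h => by
    linarith [G.K_add_β_lt hc h]
  obtain ⟨h₀, hh₀⟩ := Finite.exists_max fun h =>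
    G.K h * (Fintype.card D - 1) / (2 * (lam h - G.β) - 2 * G.K h)
  refine ⟨_, div_nonneg (mul_nonneg (G.K_pos h₀).le (sub_nonneg.2 (G.one_le_card h₀)))
    (hpos h₀).le, ?_, fun h => (div_le_iff₀ (hpos h)).1 (hh₀ h)⟩
  rw [div_lt_one (hpos h₀)]
  linarith [hc h₀]

theorem asyncReaches_errors (G : GridModel D H) {lam : H → ℝ}
    (hc : ∀ h, 0 < 2 * (lam h - G.β) - G.K h * (Fintype.card D + 1)) (l : D → H → ℝ) :
    G.AsyncReaches lam l (G.errors lam l) := by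
  have hlam := fun h => (G.K_add_β_lt hc h).le
  have hpos : ∀ h, 0 < 2 * (lam h - G.β) - 2 * G.K h := fun h => by
    linarith [G.K_add_β_lt hc h]
  intro s x₀
  constructor
  · obtain ⟨x, hx0, hx⟩ := s.exists_run (fun n (y : D → H → ℝ) h =>
      G.K h * (∑ k, l k h + l n h + (∑ k, y k h - y n h)) /
        (2 * (lam h - G.β) - 2 * G.K h)) x₀
    refine ⟨x, hx0, fun i n => ⟨fun hi => ?_, (hx i n).2⟩⟩
    rw [G.forall_update_le_update_iff hlam]
    intro h
    rw [(hx i n).1 hi, mul_div_cancel₀ _ (hpos h).ne']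
  · intro x _ hx
    obtain ⟨θ, hθ0, hθ1, hθ⟩ := G.exists_contraction_factor hc
    have herr : ∀ n, Tendsto (fun i => ‖x i n - G.errors lam l n‖) atTop (𝓝 0) := by
      refine s.tendsto_zero hθ0 hθ1 (fun i n => ‖x i n - G.errors lam l n‖)
        (fun _ _ => norm_nonneg _) (fun i n hi B hB => ?_) (fun i n hi => ?_)
      · have hB0 : 0 ≤ B := (norm_nonneg _).trans (hB n)
        rw [pi_norm_le_iff_of_nonneg (by positivity)]
        intro h
        have h1 := (G.forall_update_le_update_iff hlam n l _ _).1 ((hx i n).1 hi) h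
        have h2 := (G.forall_mul_eq_marginal_iff hlam (fun h => (hc h).ne') l _).2 rfl n h
        have h3 := abs_sum_sub_le (fun k => x (s.time n k i) k h - G.errors lam l k h) (B := B)
          (fun k => (norm_le_pi_norm (x (s.time n k i) k - G.errors lam l k) h).trans (hB k)) n
        rw [Finset.sum_sub_distrib] at h3
        rw [marginal] at h2
        have h4 : (2 * (lam h - G.β) - 2 * G.K h) * (x (i + 1) n h - G.errors lam l n h) =
            G.K h * (∑ k, x (s.time n k i) k h - ∑ k, G.errors lam l k h -
              (x (s.time n n i) n h - G.errors lam l n h)) := by linarith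
        have h5 : (2 * (lam h - G.β) - 2 * G.K h) * |x (i + 1) n h - G.errors lam l n h| ≤
            (2 * (lam h - G.β) - 2 * G.K h) * (θ * B) := by
          rw [← abs_of_pos (hpos h), ← abs_mul, abs_of_pos (hpos h), h4, abs_mul,
            abs_of_pos (G.K_pos h)]
          calc _ ≤ G.K h * ((Fintype.card D - 1) * B) :=
                mul_le_mul_of_nonneg_left h3 (G.K_pos h).le
            _ = G.K h * (Fintype.card D - 1) * B := by ring
            _ ≤ θ * (2 * (lam h - G.β) - 2 * G.K h) * B :=
                mul_le_mul_of_nonneg_right (hθ h) hB0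
            _ = _ := by ring
        exact le_of_mul_le_mul_left h5 (hpos h)
      · simp only [(hx i n).2 hi]
    rw [tendsto_pi_nhds]
    exact fun n => tendsto_iff_norm_sub_tendsto_zero.2 (herr n)

end GridModel

namespace GridModel

variable {D H : Type*} [Fintype D] [DecidableEq D] [Fintype H] [DecidableEq H]

/-! ### Asynchronous best responses in the loads and the errors -/

/-- `(m, e)` is the best response of user `n` in the game with the proximal term, with centroid `z`,
if the loads and the errors of the other users add up to `g`; stated through the first-order
conditions. -/
def IsProxResponse (G : GridModel D H) (lam : H → ℝ) (τ : ℝ) (n : D) (z g m e : H → ℝ) : Prop :=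
  m ∈ G.Ω n ∧ (∀ h, (2 * (lam h - G.β) - 2 * G.K h) * e h = G.K h * (g h + 2 * m h)) ∧
    ∀ m' ∈ G.Ω n, 0 ≤ ∑ h, (2 * (lam h - G.β) * e h + τ * (m h - z h)) * (m' h - m h)

/-- The sum of the loads and the errors of the users other than `n`. -/
def othersTotal (u x : D → H → ℝ) (n : D) (h : H) : ℝ :=
  (∑ k, u k h - u n h) + (∑ k, x k h - x n h)

theorem isUserSaddle_update_iff (G : GridModel D H) {lam : H → ℝ}
    (hlam : ∀ h, G.K h + G.β ≤ lam h) {τ : ℝ} (hτ : 0 ≤ τ) (z : D → H → ℝ) (n : D)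
    (u x : D → H → ℝ) (m e : H → ℝ) :
    IsUserSaddle (G.proxCost lam τ z) G.Ω n (Function.update u n m) (Function.update x n e) ↔
      G.IsProxResponse lam τ n (z n) (othersTotal u x n) m e := by
  have hfoc : ∀ h, (2 * (lam h - G.β) * e h =
        G.marginal (Function.update u n m) (Function.update x n e) n h ↔
      (2 * (lam h - G.β) - 2 * G.K h) * e h = G.K h * (othersTotal u x n h + 2 * m h)) := by
    intro h
    simp only [marginal, othersTotal, sum_update_apply, Function.update_self]
    constructor <;> intro h1 <;> linarith
  rw [G.isUserSaddle_iff hlam hτ]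
  simp only [Function.update_self, IsProxResponse, ← hfoc]
  refine and_congr_right fun _ => and_congr_right fun h2 => ?_
  simp only [h2]

theorem exists_isProxResponse (G : GridModel D H) {lam : H → ℝ}
    (hlam : ∀ h, G.K h + G.β < lam h) (τ : ℝ) (n : D) (z g : H → ℝ) :
    ∃ m e, G.IsProxResponse lam τ n z g m e := by
  have hpos : ∀ h, 0 < 2 * (lam h - G.β) - 2 * G.K h := fun h => by linarith [hlam h]
  let b : H → ℝ := fun h => 2 * (lam h - G.β) * G.K h / (2 * (lam h - G.β) - 2 * G.K h)
  obtain ⟨m, hm, hmin⟩ := (G.Ω_compact n).exists_isMinOn (G.Ω_nonempty n)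
    (f := fun m => ∑ h, (b h * (g h * m h + m h ^ 2) + τ / 2 * (m h - z h) ^ 2)) (by fun_prop)
  refine ⟨m, fun h => G.K h * (g h + 2 * m h) / (2 * (lam h - G.β) - 2 * G.K h), hm,
    fun h => mul_div_cancel₀ _ (hpos h).ne', ?_⟩
  refine variational_inequality_of_quadratic (G.Ω_convex n) hm _ (fun h => b h + τ / 2)
    fun m' hm' => ?_
  have h1 := sub_nonneg.2 (isMinOn_iff.1 hmin m' hm')
  simp only [← Finset.sum_sub_distrib] at h1
  rw [← Finset.sum_add_distrib]
  refine h1.trans_eq (Finset.sum_congr rfl fun h _ => ?_)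
  simp only [b]
  ring

/-- The sum of the sensitivities of the marginal costs to the aggregate of the other users. -/
noncomputable def sensitivity (G : GridModel D H) (lam : H → ℝ) : ℝ :=
  ∑ h, 2 * (lam h - G.β) * G.K h / (2 * (lam h - G.β) - 2 * G.K h)

/-- The load of a best response is Lipschitz continuous in the aggregate of the other users, with a
constant of order `1 / τ`. -/
theorem IsProxResponse.abs_load_sub_le {G : GridModel D H} {lam : H → ℝ}
    (hlam : ∀ h, G.K h + G.β < lam h) {τ : ℝ} (hτ : 0 < τ) {n : D}
    {z g m e g' m' e' : H → ℝ} (hr : G.IsProxResponse lam τ n z g m e)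
    (hr' : G.IsProxResponse lam τ n z g' m' e') {Γ : ℝ} (hΓ : ∀ h, |g h - g' h| ≤ Γ) (h : H) :
    τ * |m h - m' h| ≤ G.sensitivity lam * Γ := by
  have hpos : ∀ h, 0 < 2 * (lam h - G.β) - 2 * G.K h := fun h => by linarith [hlam h]
  have hb : ∀ h, 0 ≤ 2 * (lam h - G.β) * G.K h / (2 * (lam h - G.β) - 2 * G.K h) := fun h =>
    div_nonneg (mul_nonneg (by linarith [hpos h, G.K_pos h]) (G.K_pos h).le) (hpos h).le
  have : Nonempty H := ⟨h⟩
  obtain ⟨h₀, hh₀⟩ := Finite.exists_max fun h => |m h - m' h|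
  refine (mul_le_mul_of_nonneg_left (hh₀ h) hτ.le).trans ?_
  have he : ∀ h, 2 * (lam h - G.β) * (e h - e' h) =
      2 * (lam h - G.β) * G.K h / (2 * (lam h - G.β) - 2 * G.K h) *
        ((g h - g' h) + 2 * (m h - m' h)) := fun h => by
    have h1 : (2 * (lam h - G.β) - 2 * G.K h) * (e h - e' h) =
        G.K h * ((g h - g' h) + 2 * (m h - m' h)) := by linarith [hr.2.1 h, hr'.2.1 h]
    rw [div_mul_eq_mul_div, eq_div_iff (hpos h).ne']
    linear_combination 2 * (lam h - G.β) * h1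
  have h1 := add_nonneg (hr.2.2 _ hr'.1) (hr'.2.2 _ hr.1)
  rw [← Finset.sum_add_distrib] at h1
  have h2 : τ * ∑ h, (m h - m' h) ^ 2 ≤
      ∑ h, 2 * (lam h - G.β) * G.K h / (2 * (lam h - G.β) - 2 * G.K h) *
        (Γ * |m h₀ - m' h₀|) := by
    rw [Finset.mul_sum, ← sub_nonneg, ← Finset.sum_sub_distrib]
    refine h1.trans (Finset.sum_le_sum fun h _ => ?_)
    have h3 : -((g h - g' h) * (m h - m' h)) ≤ Γ * |m h₀ - m' h₀| := by
      refine (neg_le_abs _).trans ?_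
      rw [abs_mul]
      exact mul_le_mul (hΓ h) (hh₀ h) (abs_nonneg _) ((abs_nonneg _).trans (hΓ h))
    have h4 := mul_le_mul_of_nonneg_left h3 (hb h)
    have h5 := mul_nonneg (hb h) (sq_nonneg (m h - m' h))
    linear_combination h4 + 2 * h5 - (m h - m' h) * he h
  have h3 : |m h₀ - m' h₀| ^ 2 ≤ ∑ h, (m h - m' h) ^ 2 := by
    rw [sq_abs]
    exact Finset.single_le_sum (f := fun h => (m h - m' h) ^ 2) (fun _ _ => sq_nonneg _)
      (Finset.mem_univ h₀)
  rw [← Finset.sum_mul] at h2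
  rcases (abs_nonneg (m h₀ - m' h₀)).eq_or_lt with h4 | h4
  · rw [← h4, mul_zero]
    exact mul_nonneg (Finset.sum_nonneg fun h _ => hb h) ((abs_nonneg _).trans (hΓ h))
  · refine le_of_mul_le_mul_right ?_ h4
    calc τ * |m h₀ - m' h₀| * |m h₀ - m' h₀| = τ * |m h₀ - m' h₀| ^ 2 := by ring
      _ ≤ τ * ∑ h, (m h - m' h) ^ 2 := mul_le_mul_of_nonneg_left h3 hτ.le
      _ ≤ _ := h2
      _ = _ := by rw [sensitivity]; ring

/-- In the norm `max (‖δ_n‖, ‖l_n‖ / ε)` and for large `τ`, the best responses of the game with the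
proximal term are contractions. -/
theorem exists_prox_contraction (G : GridModel D H) {lam : H → ℝ}
    (hc : ∀ h, 0 < 2 * (lam h - G.β) - G.K h * (Fintype.card D + 1)) :
    ∃ θ ε τ₀ : ℝ, 0 ≤ θ ∧ θ < 1 ∧ 0 < ε ∧ 0 ≤ τ₀ ∧ ∀ τ, τ₀ < τ → ∀ (n : D) (z : H → ℝ)
      (u x u' x' : D → H → ℝ) (m e m' e' : H → ℝ),
      G.IsProxResponse lam τ n z (othersTotal u x n) m e →
      G.IsProxResponse lam τ n z (othersTotal u' x' n) m' e' →
      ∀ B, (∀ k, ‖x k - x' k‖ ≤ B) → (∀ k, ‖u k - u' k‖ ≤ ε * B) →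
        ‖e - e'‖ ≤ θ * B ∧ ‖m - m'‖ ≤ ε * (θ * B) := by
  have hlam := G.K_add_β_lt hc
  have hpos : ∀ h, 0 < 2 * (lam h - G.β) - 2 * G.K h := fun h => by
    linarith [G.K_add_β_lt hc h]
  obtain ⟨ρ, hρ0, hρ1, hρ⟩ := G.exists_contraction_factor hc
  set S := G.sensitivity lam with hS
  have hS0 : 0 ≤ S := Finset.sum_nonneg fun h _ =>
    div_nonneg (mul_nonneg (by linarith [hpos h, G.K_pos h]) (G.K_pos h).le) (hpos h).le
  set N := (Fintype.card D : ℝ) with hN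
  -- `ε` is so small that `(1 + ε) ^ 2 * ρ ≤ θ`
  obtain ⟨ε, hε⟩ : ∃ ε, ε = (1 - ρ) / 8 := ⟨_, rfl⟩
  obtain ⟨θ, hθ⟩ : ∃ θ, θ = (1 + ρ) / 2 := ⟨_, rfl⟩
  have hε0 : 0 < ε := by linarith
  have hθ0 : 0 < θ := by linarith
  have hεθ : (1 + ε) ^ 2 * ρ ≤ θ := by
    have h1 : (1 + ε) ^ 2 ≤ 1 + 3 * ε := by nlinarith
    nlinarith [mul_le_mul_of_nonneg_right h1 hρ0]
  refine ⟨θ, ε, max 0 (max (2 * S / ε) (S * ((N - 1) * (1 + ε)) / (ε * θ))), hθ0.le, by linarith,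
    hε0, le_max_left _ _, ?_⟩
  intro τ hτ n z u x u' x' m e m' e' hr hr' B hx hu
  have hτ0 : 0 < τ := (le_max_left _ _).trans_lt hτ
  have hτ1 : 2 * S ≤ ε * τ := by
    have := ((le_max_left _ _).trans (le_max_right _ _)).trans_lt hτ
    rw [div_lt_iff₀ hε0] at this
    linarith
  have hτ2 : S * ((N - 1) * (1 + ε)) ≤ ε * θ * τ := by
    have := ((le_max_right _ _).trans (le_max_right _ _)).trans_lt hτ
    rw [div_lt_iff₀ (by positivity)] at this
    linarith
  have hN1 : 0 ≤ N - 1 := by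
    have : 0 < Fintype.card D := Fintype.card_pos_iff.2 ⟨n⟩
    rw [sub_nonneg, hN]
    exact_mod_cast this
  have hB0 : 0 ≤ B := (norm_nonneg _).trans (hx n)
  set Γ := (N - 1) * (1 + ε) * B with hΓdef
  have hΓ0 : 0 ≤ Γ := by positivity
  have hΓ : ∀ h, |othersTotal u x n h - othersTotal u' x' n h| ≤ Γ := by
    intro h
    have h1 := abs_sum_sub_le (fun k => x k h - x' k h) (B := B)
      (fun k => (norm_le_pi_norm (x k - x' k) h).trans (hx k)) n
    have h2 := abs_sum_sub_le (fun k => u k h - u' k h) (B := ε * B)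
      (fun k => (norm_le_pi_norm (u k - u' k) h).trans (hu k)) n
    rw [Finset.sum_sub_distrib, ← hN] at h1 h2
    have h3 : othersTotal u x n h - othersTotal u' x' n h =
        (∑ k, u k h - ∑ k, u' k h - (u n h - u' n h)) +
          (∑ k, x k h - ∑ k, x' k h - (x n h - x' n h)) := by
      simp only [othersTotal]; ring
    rw [h3]
    refine (abs_add_le _ _).trans ((add_le_add h2 h1).trans_eq ?_)
    rw [hΓdef]; ring
  have hm : ∀ h, τ * |m h - m' h| ≤ S * Γ := hr.abs_load_sub_le hlam hτ0 hr' hΓ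
  constructor
  · rw [pi_norm_le_iff_of_nonneg (by positivity)]
    intro h
    have h1 : 2 * |m h - m' h| ≤ ε * Γ := by
      refine le_of_mul_le_mul_left ?_ hτ0
      nlinarith [hm h, mul_le_mul_of_nonneg_right hτ1 hΓ0]
    have h2 : (2 * (lam h - G.β) - 2 * G.K h) * (e h - e' h) =
        G.K h * ((othersTotal u x n h - othersTotal u' x' n h) + 2 * (m h - m' h)) := by
      linarith [hr.2.1 h, hr'.2.1 h]
    have h3 : (2 * (lam h - G.β) - 2 * G.K h) * |e h - e' h| ≤
        (2 * (lam h - G.β) - 2 * G.K h) * (θ * B) := by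
      rw [← abs_of_pos (hpos h), ← abs_mul, abs_of_pos (hpos h), h2, abs_mul,
        abs_of_pos (G.K_pos h)]
      have h4 : |(othersTotal u x n h - othersTotal u' x' n h) + 2 * (m h - m' h)| ≤
          Γ + ε * Γ := by
        refine (abs_add_le _ _).trans (add_le_add (hΓ h) ?_)
        rwa [abs_mul, abs_two]
      calc _ ≤ G.K h * (Γ + ε * Γ) := mul_le_mul_of_nonneg_left h4 (G.K_pos h).le
        _ = G.K h * (N - 1) * ((1 + ε) ^ 2 * B) := by rw [hΓdef]; ring
        _ ≤ ρ * (2 * (lam h - G.β) - 2 * G.K h) * ((1 + ε) ^ 2 * B) :=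
          mul_le_mul_of_nonneg_right (hρ h) (by positivity)
        _ = (2 * (lam h - G.β) - 2 * G.K h) * ((1 + ε) ^ 2 * ρ * B) := by ring
        _ ≤ _ := mul_le_mul_of_nonneg_left (mul_le_mul_of_nonneg_right hεθ hB0) (hpos h).le
    exact le_of_mul_le_mul_left h3 (hpos h)
  · rw [pi_norm_le_iff_of_nonneg (by positivity)]
    intro h
    refine le_of_mul_le_mul_left ((hm h).trans ?_) hτ0
    calc S * Γ = S * ((N - 1) * (1 + ε)) * B := by rw [hΓdef]; ring
      _ ≤ ε * θ * τ * B := mul_le_mul_of_nonneg_right hτ2 hB0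
      _ = _ := by ring

theorem totalCoeff_nonneg (G : GridModel D H) {lam : H → ℝ}
    (hc : ∀ h, 0 < 2 * (lam h - G.β) - G.K h * (Fintype.card D + 1)) (h : H) :
    0 ≤ totalCoeff D (G.K h) (2 * (lam h - G.β)) := by
  have h1 := G.two_mul_sub_sub_pos (fun h => (G.K_add_β_lt hc h).le) h
  exact div_nonneg (mul_nonneg (sq_nonneg _) (G.K_pos h).le) (mul_pos h1 (hc h)).le

theorem ownCoeff_pos (G : GridModel D H) {lam : H → ℝ}
    (hc : ∀ h, 0 < 2 * (lam h - G.β) - G.K h * (Fintype.card D + 1)) (h : H) :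
    0 < ownCoeff (G.K h) (2 * (lam h - G.β)) := by
  have h1 := G.two_mul_sub_sub_pos (fun h => (G.K_add_β_lt hc h).le) h
  exact div_pos (mul_pos (by linarith [G.K_pos h]) (G.K_pos h)) h1

theorem IsProxEquilibrium.unique {G : GridModel D H} {lam : H → ℝ}
    (hc : ∀ h, 0 < 2 * (lam h - G.β) - G.K h * (Fintype.card D + 1)) {τ : ℝ} (hτ : 0 ≤ τ)
    {z l δ l' δ' : D → H → ℝ} (hE : G.IsProxEquilibrium lam τ z l δ)
    (hE' : G.IsProxEquilibrium lam τ z l' δ') : l' = l ∧ δ' = δ := by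
  have hiff :=
    G.isProxEquilibrium_iff (fun h => (G.K_add_β_lt hc h).le) (fun h => (hc h).ne') hτ
  obtain ⟨rfl, h1⟩ := (hiff z l δ).1 hE
  obtain ⟨rfl, h2⟩ := (hiff z l' δ').1 hE'
  have h3 := h2.unique (G.totalCoeff_nonneg hc) (G.ownCoeff_pos hc) hτ h1
  exact ⟨h3, by rw [h3]⟩

theorem exists_isProxAsyncRun (G : GridModel D H) {lam : H → ℝ}
    (hlam : ∀ h, G.K h + G.β < lam h) {τ : ℝ} (hτ : 0 ≤ τ) (z : D → H → ℝ) (s : AsyncSchedule D)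
    (u₀ x₀ : D → H → ℝ) :
    ∃ u x, u 0 = u₀ ∧ x 0 = x₀ ∧ G.IsProxAsyncRun lam τ z s u x := by
  choose m e hme using G.exists_isProxResponse hlam τ
  let g : D → (D → (H → ℝ) × (H → ℝ)) → H → ℝ := fun n y =>
    othersTotal (fun k => (y k).1) (fun k => (y k).2) n
  obtain ⟨y, hy0, hy⟩ := s.exists_run (fun n y => (m n (z n) (g n y), e n (z n) (g n y)))
    fun k => (u₀ k, x₀ k)
  refine ⟨fun i n => (y i n).1, fun i n => (y i n).2, by simp [hy0], by simp [hy0],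
    fun i n => ⟨fun hi => ?_, fun hi => ?_⟩⟩
  · rw [G.isUserSaddle_update_iff (fun h => (hlam h).le) hτ]
    simp only [(hy i n).1 hi]
    exact hme n (z n) _
  · simp only [(hy i n).2 hi, and_self]

theorem exists_proxAsyncReaches (G : GridModel D H) {lam : H → ℝ}
    (hc : ∀ h, 0 < 2 * (lam h - G.β) - G.K h * (Fintype.card D + 1)) {l δ : D → H → ℝ}
    (hE : G.IsPenEquilibrium lam l δ) :
    ∃ τ₀ : ℝ, ∀ τ : ℝ, τ₀ < τ → G.ProxAsyncReaches lam τ l δ := by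
  have hlam := G.K_add_β_lt hc
  have hlam' := fun h => (hlam h).le
  obtain ⟨θ, ε, τ₀, hθ0, hθ1, hε0, hτ₀, hcontr⟩ := G.exists_prox_contraction hc
  refine ⟨τ₀, fun τ hτ => ⟨fun z _ => ?_, fun z ε hz0 hz => ?_⟩⟩
  · have hτ0 : 0 ≤ τ := hτ₀.trans hτ.le
    obtain ⟨lz, δz, hEz⟩ := G.exists_isProxEquilibrium hlam' (fun h => (hc h).ne') hτ0 z
    refine ⟨lz, δz, hEz, fun l' δ' h => hEz.unique hc hτ0 h, fun s u₀ x₀ _ =>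
      ⟨G.exists_isProxAsyncRun hlam hτ0 z s u₀ x₀, fun u x _ _ hrun => ?_⟩⟩
    have herr : ∀ n, Tendsto (fun i => max ‖x i n - δz n‖ (‖u i n - lz n‖ / ε)) atTop (𝓝 0) := by
      refine s.tendsto_zero hθ0 hθ1 (fun i n => max ‖x i n - δz n‖ (‖u i n - lz n‖ / ε))
        (fun _ _ => le_max_of_le_left (norm_nonneg _)) (fun i n hi B hB => ?_) (fun i n hi => ?_)
      · have h1 := (G.isUserSaddle_update_iff hlam' hτ0 z n _ _ _ _).1 ((hrun i n).1 hi)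
        have h2 := (G.isUserSaddle_update_iff hlam' hτ0 z n lz δz (lz n) (δz n)).1 (by
          rw [Function.update_eq_self, Function.update_eq_self]; exact hEz n)
        obtain ⟨h3, h4⟩ := hcontr τ hτ n (z n) _ _ _ _ _ _ _ _ h1 h2 B
          (fun k => (le_max_left _ _).trans (hB k)) fun k => by
            rw [mul_comm, ← div_le_iff₀ hε0]
            exact (le_max_right _ _).trans (hB k)
        refine max_le h3 ?_
        rw [div_le_iff₀ hε0, mul_comm]
        exact h4
      · simp only [(hrun i n).2 hi]
    constructor <;> rw [tendsto_pi_nhds] <;> intro n <;> rw [tendsto_iff_norm_sub_tendsto_zero]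
    · refine squeeze_zero (fun _ => norm_nonneg _) (fun i => ?_)
        (by simpa using (herr n).const_mul ε)
      rw [mul_comm, ← div_le_iff₀ hε0]
      exact le_max_right _ _
    · exact squeeze_zero (fun _ => norm_nonneg _) (fun i => le_max_left _ _) (herr n)
  · have hτ0 : 0 < τ := hτ₀.trans_lt hτ
    have hiff := fun {τ : ℝ} => G.isProxEquilibrium_iff (τ := τ) hlam' (fun h => (hc h).ne')
    obtain ⟨rfl, hl⟩ := (hiff le_rfl 0 l δ).1 ((G.isPenEquilibrium_iff_prox lam 0 l δ).1 hE)
    have hz1 := fun j => (hiff hτ0.le (z j) (z (j + 1)) (ε (j + 1))).1 (hz j)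
    have hlim : Tendsto z atTop (𝓝 l) :=
      hl.tendsto_proximal (G.totalCoeff_nonneg hc) (G.ownCoeff_pos hc) hτ0 fun j => (hz1 j).2
    refine ⟨hlim, (tendsto_add_atTop_iff_nat 1).1 ?_⟩
    simp only [fun j => (hz1 j).1]
    exact ((G.continuous_errors lam).tendsto l).comp ((tendsto_add_atTop_iff_nat 1).2 hlim)

end GridModel

/-! ### Assembly of the existence, uniqueness and convergence results -/

theorem theorem4 {D H : Type*} [Fintype D] [DecidableEq D] [Fintype H] [DecidableEq H]
    (G : GridModel D H) :
    -- (a) with the complementarity problem for the multipliers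
    (({z : (D → H → ℝ) × (D → H → ℝ) × (H → ℝ) |
          G.IsPenEquilibrium z.2.2 z.1 z.2.1 ∧ G.NCP z.2.2 z.2.1}).Nonempty ∧
      IsCompact {z : (D → H → ℝ) × (D → H → ℝ) × (H → ℝ) |
          G.IsPenEquilibrium z.2.2 z.1 z.2.1 ∧ G.NCP z.2.2 z.2.1}) ∧
    -- (a) with fixed multipliers
    (∀ lam : H → ℝ, (∀ h, G.K h + G.β ≤ lam h) →
      (∀ h, lam h ≠ 1 / 2 * G.K h * ((Fintype.card D : ℝ) + 1) + G.β) →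
      ({z : (D → H → ℝ) × (D → H → ℝ) | G.IsPenEquilibrium lam z.1 z.2}).Nonempty ∧
      IsCompact {z : (D → H → ℝ) × (D → H → ℝ) | G.IsPenEquilibrium lam z.1 z.2}) ∧
    -- (b)
    (∃ l δ : D → H → ℝ, G.IsVariationalSolution l δ) ∧
    -- (c)
    (∀ lam : H → ℝ, (∀ h, 1 / 2 * G.K h * ((Fintype.card D : ℝ) + 1) + G.β < lam h) →
      G.StronglyMonotoneInErrors lam ∧
      (∃ l δ : D → H → ℝ, G.IsPenEquilibrium lam l δ ∧ G.IsPenMinMaxEquilibrium lam l δ ∧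
        (∀ l' δ' : D → H → ℝ,
          G.IsPenEquilibrium lam l' δ' ∨ G.IsPenMinMaxEquilibrium lam l' δ' →
            l' = l ∧ δ' = δ) ∧
        G.AsyncReaches lam l δ ∧
        ∃ τ₀ : ℝ, ∀ τ : ℝ, τ₀ < τ → G.ProxAsyncReaches lam τ l δ) ∧
      (∀ l : D → H → ℝ, (∀ n, l n ∈ G.Ω n) →
        ∃ δ : D → H → ℝ, G.IsInnerEquilibrium lam l δ ∧
          (∀ δ' : D → H → ℝ, G.IsInnerEquilibrium lam l δ' → δ' = δ) ∧
          G.AsyncReaches lam l δ)) := by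
  have hne : ∀ lam : H → ℝ, (∀ h, lam h ≠ 1 / 2 * G.K h * ((Fintype.card D : ℝ) + 1) + G.β) →
      ∀ h, 2 * (lam h - G.β) - G.K h * (Fintype.card D + 1) ≠ 0 :=
    fun lam hlam h h0 => hlam h (by linarith)
  refine ⟨⟨?_, G.isCompact_setOf_isPenEquilibrium_ncp⟩, fun lam hlam hlam' => ⟨?_,
    G.isCompact_setOf_isPenEquilibrium hlam (hne lam hlam')⟩, ?_, fun lam hlam => ?_⟩
  · obtain ⟨l, δ, lam, h⟩ := G.exists_isPenEquilibrium_ncp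
    exact ⟨(l, δ, lam), h⟩
  · obtain ⟨l, δ, h⟩ := G.exists_isProxEquilibrium hlam (hne lam hlam') le_rfl 0
    exact ⟨(l, δ), (G.isPenEquilibrium_iff_prox lam 0 l δ).2 h⟩
  · obtain ⟨l, δ, lam, hE, hN⟩ := G.exists_isPenEquilibrium_ncp
    exact ⟨l, δ, hE.isVariationalSolution hN⟩
  · have hc : ∀ h, 0 < 2 * (lam h - G.β) - G.K h * (Fintype.card D + 1) :=
      fun h => by linarith [hlam h]
    have hK := G.K_add_β_lt hc
    have hKle := fun h => (hK h).le
    have hinner := G.isInnerEquilibrium_iff hKle fun h => (hc h).ne'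
    refine ⟨G.stronglyMonotoneInErrors hc, ?_, fun l _ => ⟨G.errors lam l, (hinner l _).2 rfl,
      fun δ' h => (hinner l δ').1 h, G.asyncReaches_errors hc l⟩⟩
    obtain ⟨l, δ, hE⟩ := G.exists_isProxEquilibrium hKle (fun h => (hc h).ne') le_rfl 0
    have hpen := (G.isPenEquilibrium_iff_prox lam 0 l δ).2 hE
    refine ⟨l, δ, hpen, hpen.isPenMinMaxEquilibrium, fun l' δ' h => ?_, ?_,
      G.exists_proxAsyncReaches hc hpen⟩
    · have h' : G.IsPenEquilibrium lam l' δ' := h.elim id fun h => h.isPenEquilibrium hK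
      exact hE.unique hc le_rfl ((G.isPenEquilibrium_iff_prox lam 0 l' δ').1 h')
    · rw [((G.isProxEquilibrium_iff hKle (fun h => (hc h).ne') le_rfl 0 l δ).1 hE).1]
      exact G.asyncReaches_errors hc l
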